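/- For positive integers $a,b$ let $R(a,b)$ be the smallest positive integer $n$ such that every graph on $n$ vertices contains a clique of size $a$ or an independent set of size $b$. Let $\alpha(k,\ell)$ be a function of pairs of positive integers with positive real values. Put \[\alpha^\ast(k,\ell)=\frac{\lfloor\alpha(k,\ell)\binom{k+\ell}{k}\rfloor}{\binom{k+\ell}{k}}.\] For real $\beta,\gamma$ and positive integers $k,\ell,r$, the function $\alpha$ is called $(\beta,\gamma)$-smooth for $(k,\ell,r)$ if for every $m\in\{1,2,r-1\}$ \[R(k+1-m,\ell+1)\le\alpha(k-m,\ell)\binom{k+\ell-m}{\ell},\qquad \frac{\alpha(k-m,\ell)}{\alpha^\ast(k,\ell)}\le 1+m\beta,\] \[R(k+1,\ell+1-m)\le\alpha(k,\ell-m)\binom{k+\ell-m}{k},\qquad \frac{\alpha(k,\ell-m)}{\alpha^\ast(k,\ell)}\le 1+m\gamma.\] **Proposition.** For every $\varepsilon>0$ there is $c_\varepsilon>0$, depending only on $\varepsilon$, such that the following holds. Let $\alpha$ be a symmetric function as above, let $k,\ell,r$ be positive integers and let $\beta,\gamma\in\mathbb{R}$. Suppose that $\alpha$ is $(\beta,\gamma)$-smooth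 for $(k,\ell,r)$, that $\ell/k\in[\varepsilon,1]$, that \[|\beta|+|\gamma|\le \frac{r(\log k)^2}{k},\qquad \alpha(k,\ell)\ge\exp\!\Big(-r\,\frac{\ell}{k}\log k\Big),\qquad r\le c_\varepsilon\log k,\qquad k\beta+\ell\gamma\le\frac{(r-3)\ell}{2k}.\] Then \[R(k+1,\ell+1)\le\alpha(k,\ell)\binom{k+\ell}{k}.\] -/

import Mathlib

namespace RamseyBound

/-- Every graph on `n` vertices contains a clique of size `a` or an independent set of size `b`. -/
def RamseyProp (a b n : ℕ) : Prop :=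
  ∀ G : SimpleGraph (Fin n),
    (∃ s : Finset (Fin n), G.IsNClique a s) ∨ (∃ s : Finset (Fin n), G.IsNIndepSet b s)

/-- The Ramsey number `R(a, b)`: the smallest positive integer `n` such that every graph on `n`
vertices contains a clique of size `a` or an independent set of size `b`. -/
noncomputable def ramsey (a b : ℕ) : ℕ :=
  sInf {n : ℕ | 0 < n ∧ RamseyProp a b n}

/-- `α*(k, l) = ⌊α(k, l) * binom(k + l, k)⌋ / binom(k + l, k)`. -/
noncomputable def alphaStar (α : ℕ → ℕ → ℝ) (k l : ℕ) : ℝ :=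
  (⌊α k l * ((k + l).choose k : ℝ)⌋ : ℝ) / ((k + l).choose k : ℝ)

/-- `α` is `(β, γ)`-smooth for `(k, l, r)`. -/
def IsSmooth (α : ℕ → ℕ → ℝ) (β γ : ℝ) (k l r : ℕ) : Prop :=
  ∀ m ∈ ({1, 2, r - 1} : Set ℕ),
    (ramsey (k + 1 - m) (l + 1) : ℝ) ≤ α (k - m) l * ((k + l - m).choose l : ℝ) ∧
    α (k - m) l / alphaStar α k l ≤ 1 + m * β ∧
    (ramsey (k + 1) (l + 1 - m) : ℝ) ≤ α k (l - m) * ((k + l - m).choose k : ℝ) ∧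
    α k (l - m) / alphaStar α k l ≤ 1 + m * γ

/-- Ramsey's theorem inside a finite set of vertices of an arbitrary graph. -/
theorem exists_ramsey_bound (a b : ℕ) :
    ∃ N : ℕ, ∀ (V : Type) (G : SimpleGraph V) (S : Finset V), N ≤ S.card →
      (∃ s ⊆ S, G.IsNClique a s) ∨ (∃ s ⊆ S, G.IsNIndepSet b s) := by
  classical
  induction a generalizing b with
  | zero => exact ⟨0, fun V G S _ => Or.inl ⟨∅, by simp, by simp⟩⟩
  | succ a iha =>
    induction b with
    | zero =>
      exact ⟨0, fun V G S _ => Or.inr ⟨∅, by simp, by simp [SimpleGraph.isNIndepSet_iff]⟩⟩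
    | succ b ihb =>
      obtain ⟨N₁, h₁⟩ := iha (b + 1)
      obtain ⟨N₂, h₂⟩ := ihb
      refine ⟨N₁ + N₂ + 1, fun V G S hS => ?_⟩
      obtain ⟨v, hv⟩ : S.Nonempty := Finset.card_pos.mp (by omega)
      have hcard := Finset.card_filter_add_card_filter_not (s := S.erase v) (fun w => G.Adj v w)
      rw [Finset.card_erase_of_mem hv] at hcard
      by_cases hA : N₁ ≤ ((S.erase v).filter (fun w => G.Adj v w)).card
      · rcases h₁ V G _ hA with ⟨s, hs, hc⟩ | ⟨s, hs, hc⟩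
        · refine Or.inl ⟨insert v s, ?_, hc.insert fun w hw => (Finset.mem_filter.mp (hs hw)).2⟩
          intro w hw
          rcases Finset.mem_insert.mp hw with rfl | hw
          · exact hv
          · exact Finset.mem_of_mem_erase (Finset.mem_filter.mp (hs hw)).1
        · exact Or.inr ⟨s, fun w hw =>
            Finset.mem_of_mem_erase (Finset.mem_filter.mp (hs hw)).1, hc⟩
      · have hB : N₂ ≤ ((S.erase v).filter (fun w => ¬ G.Adj v w)).card := by omega
        rcases h₂ V G _ hB with ⟨s, hs, hc⟩ | ⟨s, hs, hc⟩
        · exact Or.inl ⟨s, fun w hw =>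
            Finset.mem_of_mem_erase (Finset.mem_filter.mp (hs hw)).1, hc⟩
        · refine Or.inr ⟨insert v s, ?_, ?_⟩
          · intro w hw
            rcases Finset.mem_insert.mp hw with rfl | hw
            · exact hv
            · exact Finset.mem_of_mem_erase (Finset.mem_filter.mp (hs hw)).1
          · rw [← SimpleGraph.isNClique_compl] at hc ⊢
            refine hc.insert fun w hw => ?_
            have hw' := Finset.mem_filter.mp (hs hw)
            exact (SimpleGraph.compl_adj _ _ _).mpr ⟨(Finset.ne_of_mem_erase hw'.1).symm, hw'.2⟩

/-- The set in the definition of `ramsey` is nonempty, so its infimum is attained. -/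
theorem ramsey_spec (a b : ℕ) : 0 < ramsey a b ∧ RamseyProp a b (ramsey a b) := by
  have hne : {n : ℕ | 0 < n ∧ RamseyProp a b n}.Nonempty := by
    obtain ⟨N, hN⟩ := exists_ramsey_bound a b
    refine ⟨N + 1, Nat.succ_pos _, fun G => ?_⟩
    rcases hN (Fin (N + 1)) G Finset.univ (by simp) with ⟨s, _, hs⟩ | ⟨s, _, hs⟩
    · exact Or.inl ⟨s, hs⟩
    · exact Or.inr ⟨s, hs⟩
  exact Nat.sInf_mem hne

end RamseyBound

/-! Put n = ⌊α(k,l)·binom(k+l,k)⌋, p = k/(k+l), q = l/(k+l), m = r-1, and suppose that a graph G on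
n vertices has no clique of size k+1 and no independent set of size l+1. The common neighbourhood of
a clique with 1, 2 or m vertices avoids smaller Ramsey configurations. So smoothness bounds degrees
by (1+β)pn, codegrees of adjacent pairs by (1+2β)p²n, and common neighbourhoods of m-cliques by
(1+mβ)n times a ratio of binomials; the complement satisfies the same with q and γ. The ratio of
binomials falls below p^m by a factor exp(-m(m-1)l/(2k(k+l))) (`chooseRatio_le`), and this deficit
produces the contradiction.

Let F = A - p, with A the adjacency kernel. Codegree bounds in G and in its complement together
bound from above the inner product of any two distinct rows of F (`DegreeBounds.codev_le`).
Entrywise powers of a Gram matrix have nonnegative total sum (`sum_codev_pow_nonneg`), so these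
one-sided bounds yield bounds on absolute moments (`SmallCodev.sum_abs_codev_pow_le`). Hence both
graphs are quasirandom enough to count cliques with up to m vertices.

Average the number of common neighbours over all m-cliques. Expanding ∏(1+F/p) (`prod_one_add_eq`),
the terms of order one and two form a weight on pairs, and the rest is of order σ³
(`Quasirandom.abs_sum_cubicRem_le`). The average of a pair weight over cliques is close to its
average over edges (`Quasirandom.abs_ratio_sub_zero_le`), which bounds the total weight of the edges
(`Quasirandom.sum_pairWeight_le`). Add the scaled inequalities for G and its complement: the
quadratic terms now run over all pairs and are nonnegative up to O(n²) (`sum_codev_add_compl_ge`),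
and the linear terms are controlled by the degrees of the complement because q ≤ p. By
`Quasirandom.linear_bound` and `edge_terms_eq`, k²(kβ+lγ)/(k+l)³ - (m-1)kl/(2(k+l)³) plus errors is
nonnegative. But kβ+lγ ≤ (m-2)l/(2k) makes it at most -kl/(2(k+l)³) plus errors, which is negative
for large k.

This needs m ≥ 2. For m = 0 smoothness already contains the claim, and for m = 1 counting the
degrees of one vertex suffices (`ramsey_le_of_degrees`). -/

namespace RamseyBound

open Finset

/-! ### Moments of a kernel whose rows have small inner products -/

section Moments

variable {V : Type*} [Fintype V]

/-- Inner product of two rows of a kernel. -/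
def codev (F : V → V → ℝ) (u w : V) : ℝ := ∑ x, F u x * F w x

/-- Expanding the square and summing over `a` first, the sum factors over the coordinates, each
contributing one inner product. -/
theorem sum_sq_sum_prod (F : V → V → ℝ) (b : V → ℝ) (ι : Type*) [Fintype ι] [DecidableEq ι] :
    ∑ a : ι → V, (∑ w, b w * ∏ i, F w (a i)) ^ 2 =
      ∑ w, ∑ w', b w * b w' * codev F w w' ^ Fintype.card ι := by
  have h (w w' : V) : codev F w w' ^ Fintype.card ι = ∑ a : ι → V, ∏ i, (F w (a i) * F w' (a i)) := by
    have := Finset.prod_univ_sum (fun _ : ι => (Finset.univ : Finset V))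
      (fun _ x => F w x * F w' x)
    rw [Fintype.piFinset_univ] at this
    rw [← this]
    simp [codev]
  simp_rw [h, sq, Finset.sum_mul_sum, Finset.mul_sum]
  rw [Finset.sum_comm]
  refine Finset.sum_congr rfl fun w _ => ?_
  rw [Finset.sum_comm]
  refine Finset.sum_congr rfl fun w' _ => Finset.sum_congr rfl fun a _ => ?_
  rw [Finset.prod_mul_distrib]
  ring

theorem sum_codev_pow_nonneg (F : V → V → ℝ) (d : ℕ) : 0 ≤ ∑ u, ∑ w, codev F u w ^ d := by
  have h := sum_sq_sum_prod F (fun _ => 1) (Fin d)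
  simp only [Fintype.card_fin, one_mul] at h
  rw [← h]
  exact Finset.sum_nonneg fun _ _ => sq_nonneg _

theorem abs_codev_le {F : V → V → ℝ} (hF : ∀ u w, |F u w| ≤ 1) (u w : V) :
    |codev F u w| ≤ Fintype.card V := by
  refine (Finset.abs_sum_le_sum_abs _ _).trans ?_
  refine (Finset.sum_le_sum (g := fun _ => (1 : ℝ)) fun x _ => ?_).trans (by simp)
  rw [abs_mul]
  exact mul_le_one₀ (hF _ _) (abs_nonneg _) (hF _ _)

/-- The rows of `F` are bounded, and distinct rows have small inner products from above. -/
structure SmallCodev (F : V → V → ℝ) (σ : ℝ) : Prop where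
  pos : 0 < σ
  le_one : σ ≤ 1
  abs_le : ∀ u w, |F u w| ≤ 1
  codev_le : ∀ u w, u ≠ w → codev F u w ≤ σ ^ 2 * Fintype.card V
  card_ge : 1 ≤ σ ^ 6 * Fintype.card V

variable {F : V → V → ℝ} {σ : ℝ}

theorem SmallCodev.card_pos (h : SmallCodev F σ) : (0 : ℝ) < Fintype.card V := by
  by_contra hn
  have h1 := h.card_ge
  have h2 := mul_nonpos_of_nonneg_of_nonpos (pow_nonneg h.pos.le 6) (not_lt.mp hn)
  linarith

/-- For odd d, |x|^d is twice the d-th power of the positive part minus x^d. The total of the x^d is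
nonnegative, so only positive parts count, and those are bounded by hypothesis. The diagonal is
absorbed through `card_ge`, whose exponent 6 covers d ≤ 3. -/
theorem SmallCodev.sum_abs_codev_pow_le (h : SmallCodev F σ) {d : ℕ} (hd : Odd d) (hd3 : d ≤ 3) :
    ∑ u, ∑ w, |codev F u w| ^ d ≤ 4 * σ ^ (2 * d) * (Fintype.card V : ℝ) ^ (d + 2) := by
  classical
  set n : ℝ := (Fintype.card V : ℝ) with hn
  have hn0 : 0 < n := h.card_pos
  have hσ := h.pos
  have key (u w : V) : |codev F u w| ^ d ≤
      2 * (σ ^ (2 * d) * n ^ d + if u = w then n ^ d else 0) - codev F u w ^ d := by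
    have hsn : 0 ≤ σ ^ (2 * d) * n ^ d := by positivity
    rcases le_or_gt 0 (codev F u w) with h0 | h0
    · rw [abs_of_nonneg h0]
      have : codev F u w ^ d ≤ σ ^ (2 * d) * n ^ d + if u = w then n ^ d else 0 := by
        split_ifs with huw
        · have := pow_le_pow_left₀ h0 ((le_abs_self _).trans (abs_codev_le h.abs_le u w)) d
          linarith
        · rw [add_zero, pow_mul, ← mul_pow]
          exact pow_le_pow_left₀ h0 (h.codev_le u w huw) d
      linarith
    · rw [abs_of_neg h0, hd.neg_pow]
      have : 0 ≤ if u = w then n ^ d else 0 := by split_ifs <;> positivity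
      linarith
  have h1 : ∑ u, ∑ w, |codev F u w| ^ d ≤ 2 * (σ ^ (2 * d) * n ^ (d + 2) + n ^ (d + 1)) := by
    refine (Finset.sum_le_sum fun u _ => Finset.sum_le_sum fun w _ => key u w).trans ?_
    have h2 := sum_codev_pow_nonneg F d
    simp only [Finset.sum_sub_distrib, ← Finset.mul_sum, Finset.sum_add_distrib, Finset.sum_const,
      Finset.sum_ite_eq, Finset.mem_univ, if_true, Finset.card_univ, nsmul_eq_mul, ← hn]
    have e : n * (n * n ^ d) = n ^ (d + 2) := by ring
    rw [e, pow_succ n d]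
    linarith [mul_comm n (n ^ d)]
  have h3 : n ^ (d + 1) ≤ σ ^ (2 * d) * n ^ (d + 2) := by
    have h4 : σ ^ 6 ≤ σ ^ (2 * d) := pow_le_pow_of_le_one hσ.le h.le_one (by omega)
    have h5 : 1 ≤ σ ^ (2 * d) * n := h.card_ge.trans (mul_le_mul_of_nonneg_right h4 hn0.le)
    have : 0 < n ^ (d + 1) := by positivity
    calc n ^ (d + 1) = 1 * n ^ (d + 1) := by ring
      _ ≤ σ ^ (2 * d) * n * n ^ (d + 1) := mul_le_mul_of_nonneg_right h5 this.le
      _ = _ := by ring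
  linarith

/-- The exponent 2 is even, so it is interpolated between 1 and 3: 2x² ≤ sx + x³/s for x ≥ 0, with s
= σ²n. -/
theorem SmallCodev.sum_sq_codev_le (h : SmallCodev F σ) :
    ∑ u, ∑ w, codev F u w ^ 2 ≤ 4 * σ ^ 4 * (Fintype.card V : ℝ) ^ 4 := by
  set n : ℝ := (Fintype.card V : ℝ) with hn
  have hn0 : 0 < n := h.card_pos
  have hσ := h.pos
  have h1 := h.sum_abs_codev_pow_le (d := 1) (by decide) (by norm_num)
  have h3 := h.sum_abs_codev_pow_le (d := 3) (by decide) (by norm_num)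
  have key (u w : V) : codev F u w ^ 2 ≤
      (σ ^ 2 * n / 2) * |codev F u w| ^ 1 + (1 / (2 * (σ ^ 2 * n))) * |codev F u w| ^ 3 := by
    set x := |codev F u w|
    have hx : 0 ≤ x := abs_nonneg _
    have hs : 0 < σ ^ 2 * n := by positivity
    rw [← sq_abs]
    change x ^ 2 ≤ _
    have : (σ ^ 2 * n / 2) * x ^ 1 + (1 / (2 * (σ ^ 2 * n))) * x ^ 3 - x ^ 2 =
        x * (σ ^ 2 * n - x) ^ 2 / (2 * (σ ^ 2 * n)) := by
      field_simp
      ring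
    have : 0 ≤ x * (σ ^ 2 * n - x) ^ 2 / (2 * (σ ^ 2 * n)) := by positivity
    linarith
  calc ∑ u, ∑ w, codev F u w ^ 2
      ≤ (σ ^ 2 * n / 2) * ∑ u, ∑ w, |codev F u w| ^ 1 +
        (1 / (2 * (σ ^ 2 * n))) * ∑ u, ∑ w, |codev F u w| ^ 3 := by
        simp only [Finset.mul_sum, ← Finset.sum_add_distrib]
        exact Finset.sum_le_sum fun u _ => Finset.sum_le_sum fun w _ => key u w
    _ ≤ (σ ^ 2 * n / 2) * (4 * σ ^ (2 * 1) * n ^ (1 + 2)) +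
        (1 / (2 * (σ ^ 2 * n))) * (4 * σ ^ (2 * 3) * n ^ (3 + 2)) := by gcongr
    _ = 4 * σ ^ 4 * n ^ 4 := by
        field_simp
        ring

theorem SmallCodev.sum_sq_prod_le (h : SmallCodev F σ) (ι : Type*) [Fintype ι] [DecidableEq ι]
    (hd : Odd (Fintype.card ι)) (hd3 : Fintype.card ι ≤ 3) {b : V → ℝ} (hb : ∀ w, |b w| ≤ 1) :
    ∑ a : ι → V, (∑ w, b w * ∏ i, F w (a i)) ^ 2 ≤
      4 * σ ^ (2 * Fintype.card ι) * (Fintype.card V : ℝ) ^ (Fintype.card ι + 2) := by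
  rw [sum_sq_sum_prod]
  refine le_trans (Finset.sum_le_sum fun u _ => Finset.sum_le_sum fun w _ => ?_)
    (h.sum_abs_codev_pow_le hd hd3)
  refine (le_abs_self _).trans ?_
  rw [abs_mul, abs_mul, abs_pow]
  exact mul_le_of_le_one_left (by positivity) (mul_le_one₀ (hb _) (abs_nonneg _) (hb _))

theorem SmallCodev.sum_abs_prod_le (h : SmallCodev F σ) (ι : Type*) [Fintype ι] [DecidableEq ι]
    (hd : Odd (Fintype.card ι)) (hd3 : Fintype.card ι ≤ 3) {b : V → ℝ} (hb : ∀ w, |b w| ≤ 1) :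
    ∑ a : ι → V, |∑ w, b w * ∏ i, F w (a i)| ≤
      2 * σ ^ Fintype.card ι * (Fintype.card V : ℝ) ^ (Fintype.card ι + 1) := by
  have hn0 := h.card_pos
  have hσ := h.pos
  refine abs_le_of_sq_le_sq' ?_ (by positivity) |>.2
  have h1 := h.sum_sq_prod_le ι hd hd3 hb
  have h2 := Finset.sum_mul_sq_le_sq_mul_sq (Finset.univ : Finset (ι → V)) (fun _ => (1 : ℝ))
    (fun a => |∑ w, b w * ∏ i, F w (a i)|)
  simp only [one_mul, one_pow, Finset.sum_const, Finset.card_univ, Fintype.card_fun, nsmul_eq_mul,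
    mul_one, sq_abs] at h2
  refine h2.trans ?_
  push_cast
  calc (Fintype.card V : ℝ) ^ Fintype.card ι * ∑ a : ι → V, (∑ w, b w * ∏ i, F w (a i)) ^ 2
      ≤ (Fintype.card V : ℝ) ^ Fintype.card ι *
        (4 * σ ^ (2 * Fintype.card ι) * (Fintype.card V : ℝ) ^ (Fintype.card ι + 2)) := by gcongr
    _ = _ := by ring

/-- One-variable version, against a weight in the free variable. -/
theorem SmallCodev.abs_sum_weight_le (h : SmallCodev F σ) {b : V → ℝ} (hb : ∀ w, |b w| ≤ 1)
    (ψ : V → ℝ) :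
    |∑ x, ψ x * ∑ w, b w * F w x| ≤
      √(∑ x, ψ x ^ 2) * (2 * σ * √(Fintype.card V : ℝ) ^ 3) := by
  have hn0 := h.card_pos
  have hσ := h.pos
  have h1 : ∑ x, (∑ w, b w * F w x) ^ 2 ≤ (2 * σ * √(Fintype.card V : ℝ) ^ 3) ^ 2 := by
    have h2 := h.sum_sq_prod_le (Fin 1) (by simp) (by simp) hb
    rw [← (Equiv.funUnique (Fin 1) V).symm.sum_comp] at h2
    simp only [Fintype.card_fin, Finset.univ_unique, Finset.prod_singleton] at h2
    refine h2.trans (le_of_eq ?_)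
    have e : (2 * σ * √(Fintype.card V : ℝ) ^ 3) ^ 2 = 4 * σ ^ 2 * (√(Fintype.card V : ℝ) ^ 2) ^ 3 := by
      ring
    rw [e, Real.sq_sqrt hn0.le]
  have h3 := Finset.sum_mul_sq_le_sq_mul_sq Finset.univ ψ (fun x => ∑ w, b w * F w x)
  have h4 : 0 ≤ ∑ x, ψ x ^ 2 := Finset.sum_nonneg fun _ _ => sq_nonneg _
  refine abs_le_of_sq_le_sq ?_ (by positivity)
  rw [mul_pow, Real.sq_sqrt h4]
  exact h3.trans (mul_le_mul_of_nonneg_left h1 h4)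

end Moments

/-! ### Weighted clique counts -/

section Cliques

variable {V : Type*}

open Classical in
/-- Adjacency as a real number. -/
noncomputable def adjInd (G : SimpleGraph V) (u v : V) : ℝ := if G.Adj u v then 1 else 0

open Classical in
/-- Indicator of the tuples that span a clique. -/
noncomputable def cliqueInd (G : SimpleGraph V) {ι : Type*} (v : ι → V) : ℝ :=
  if Pairwise fun i j => G.Adj (v i) (v j) then 1 else 0

/-- Number of ordered cliques with `s` vertices. -/
noncomputable def cliqueCount [Fintype V] (G : SimpleGraph V) (s : ℕ) : ℝ :=
  ∑ v : Fin s → V, cliqueInd G v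

/-- Deviation of the adjacency kernel from the constant `p`. -/
noncomputable def dev (G : SimpleGraph V) (p : ℝ) (u v : V) : ℝ := adjInd G u v - p

variable (G : SimpleGraph V)

theorem adjInd_nonneg (u v : V) : 0 ≤ adjInd G u v := by unfold adjInd; split_ifs <;> norm_num

theorem adjInd_le_one (u v : V) : adjInd G u v ≤ 1 := by unfold adjInd; split_ifs <;> norm_num

theorem adjInd_comm (u v : V) : adjInd G u v = adjInd G v u := by
  rw [adjInd, adjInd]
  congr 1
  exact propext (G.adj_comm u v)

theorem adjInd_self (u : V) : adjInd G u u = 0 := by simp [adjInd]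

theorem dev_comm (p : ℝ) (u v : V) : dev G p u v = dev G p v u := by
  rw [dev, dev, adjInd_comm]

theorem abs_dev_le {p : ℝ} (h0 : 0 ≤ p) (h1 : p ≤ 1) (u v : V) : |dev G p u v| ≤ 1 := by
  have := adjInd_nonneg G u v
  have := adjInd_le_one G u v
  rw [dev, abs_le]
  constructor <;> linarith

theorem cliqueInd_nonneg {ι : Type*} (v : ι → V) : 0 ≤ cliqueInd G v := by
  unfold cliqueInd; split_ifs <;> norm_num

theorem cliqueInd_le_comp {ι κ : Type*} (v : ι → V) {e : κ → ι} (he : Function.Injective e) :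
    cliqueInd G v ≤ cliqueInd G (v ∘ e) := by
  by_cases h : Pairwise fun i j => G.Adj (v i) (v j)
  · have h' : Pairwise fun i j => G.Adj ((v ∘ e) i) ((v ∘ e) j) := fun i j hij => h (he.ne hij)
    rw [cliqueInd, if_pos h, cliqueInd, if_pos h']
  · rw [cliqueInd, if_neg h]
    exact cliqueInd_nonneg G _

theorem cliqueInd_comp_equiv {ι κ : Type*} (v : ι → V) (e : κ ≃ ι) :
    cliqueInd G (v ∘ e) = cliqueInd G v := by
  refine le_antisymm ?_ (cliqueInd_le_comp G v e.injective)
  have := cliqueInd_le_comp G (v ∘ e) e.symm.injective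
  simpa [Function.comp_assoc] using this

theorem cliqueInd_cons {s : ℕ} (x : V) (u : Fin s → V) :
    cliqueInd G (Fin.cons x u : Fin (s + 1) → V) = cliqueInd G u * ∏ i, adjInd G x (u i) := by
  by_cases hu : Pairwise fun i j => G.Adj (u i) (u j)
  · by_cases hx : ∀ i, G.Adj x (u i)
    · have h : Pairwise fun i j => G.Adj ((Fin.cons x u : Fin (s + 1) → V) i)
          ((Fin.cons x u : Fin (s + 1) → V) j) := by
        intro i j
        induction i using Fin.cases with
        | zero =>
          induction j using Fin.cases with
          | zero => simp
          | succ j => intro _; simpa using hx j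
        | succ i =>
          induction j using Fin.cases with
          | zero => intro _; simpa using (hx i).symm
          | succ j =>
            intro hij
            simpa using hu (fun h => hij (by rw [h]))
      rw [cliqueInd, if_pos h, cliqueInd, if_pos hu]
      simp [adjInd, hx]
    · have h : ¬ Pairwise fun i j => G.Adj ((Fin.cons x u : Fin (s + 1) → V) i)
          ((Fin.cons x u : Fin (s + 1) → V) j) := by
        intro h
        exact hx fun i => by simpa using h (Fin.succ_ne_zero i).symm
      rw [cliqueInd, if_neg h]
      push Not at hx
      obtain ⟨i, hi⟩ := hx
      rw [Finset.prod_eq_zero (Finset.mem_univ i) (by simp [adjInd, hi]), mul_zero]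
  · have h := cliqueInd_le_comp G (Fin.cons x u : Fin (s + 1) → V) (Fin.succ_injective s)
    have e : (Fin.cons x u : Fin (s + 1) → V) ∘ Fin.succ = u := by ext i; simp
    rw [e, cliqueInd.eq_def G u, if_neg hu] at h
    rw [cliqueInd.eq_def G u, if_neg hu, zero_mul]
    exact le_antisymm h (cliqueInd_nonneg G _)

variable {G}

theorem prod_adjInd_nonneg {s : ℕ} (w : V) (u : Fin s → V) : 0 ≤ ∏ i, adjInd G w (u i) :=
  Finset.prod_nonneg fun _ _ => adjInd_nonneg G _ _

theorem prod_adjInd_le_one {s : ℕ} (w : V) (u : Fin s → V) : ∏ i, adjInd G w (u i) ≤ 1 :=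
  Finset.prod_le_one (fun _ _ => adjInd_nonneg G _ _) fun _ _ => adjInd_le_one G _ _

variable (G) [Fintype V]

theorem sum_fin_cons {M : Type*} [AddCommMonoid M] {s : ℕ} (f : (Fin (s + 1) → V) → M) :
    ∑ v, f v = ∑ x, ∑ u : Fin s → V, f (Fin.cons x u) := by
  rw [← Fintype.sum_prod_type', ← (Fin.consEquiv (fun _ => V)).sum_comp]
  rfl

theorem sum_cliqueInd (ι : Type*) [Fintype ι] [DecidableEq ι] :
    ∑ v : ι → V, cliqueInd G v = cliqueCount G (Fintype.card ι) := by
  rw [cliqueCount, ← ((Fintype.equivFin ι).arrowCongr (Equiv.refl V)).sum_comp]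
  refine Finset.sum_congr rfl fun v _ => ?_
  exact (cliqueInd_comp_equiv G v (Fintype.equivFin ι).symm).symm

theorem cliqueCount_nonneg (s : ℕ) : 0 ≤ cliqueCount G s :=
  Finset.sum_nonneg fun _ _ => cliqueInd_nonneg G _

theorem cliqueCount_zero : cliqueCount G 0 = 1 := by
  simp [cliqueCount, cliqueInd, Pairwise]

theorem cliqueCount_succ (s : ℕ) :
    cliqueCount G (s + 1) =
      ∑ v : Fin s → V, cliqueInd G v * ∑ w, ∏ i, adjInd G w (v i) := by
  rw [cliqueCount, sum_fin_cons, Finset.sum_comm]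
  simp_rw [cliqueInd_cons, Finset.mul_sum]

theorem cliqueCount_one : cliqueCount G 1 = Fintype.card V := by
  rw [cliqueCount_succ]
  simp [cliqueInd, Pairwise]

variable {G} {F : V → V → ℝ} {σ : ℝ}

/-- With the coordinates outside `S` frozen, `b` is a fixed bounded function of w and the moment
bound applies to the coordinates in `S`. The frozen coordinates must still span a clique, which
gives the smaller clique count. -/
theorem SmallCodev.abs_sum_split_le (h : SmallCodev F σ) {s : ℕ} (S : Finset (Fin s))
    (hd : Odd S.card) (hd3 : S.card ≤ 3) {κ : (Fin s → V) → ℝ}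
    (hκ : ∀ v, |κ v| ≤ cliqueInd G (fun i : {i // i ∉ S} => v i))
    {b : V → (Fin s → V) → ℝ} (hb : ∀ w v, |b w v| ≤ 1)
    (hbS : ∀ w v v', (∀ i ∉ S, v i = v' i) → b w v = b w v') :
    |∑ v, κ v * ∑ w, b w v * ∏ i ∈ S, F w (v i)| ≤
      cliqueCount G (s - S.card) * (2 * σ ^ S.card * (Fintype.card V : ℝ) ^ (S.card + 1)) := by
  classical
  let e := Equiv.piEquivPiSubtypeProd (fun i => i ∈ S) (fun _ : Fin s => V)
  have hcard : Fintype.card {i // i ∉ S} = s - S.card := by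
    rw [Fintype.card_subtype_compl]; simp
  have hcardS : Fintype.card {i // i ∈ S} = S.card := by simp
  -- An arbitrary filler for the coordinates in `S`, on which `b` does not depend.
  obtain ⟨x₀⟩ : Nonempty V := by
    rw [← Fintype.card_pos_iff]; exact_mod_cast h.card_pos
  rw [← e.symm.sum_comp, Fintype.sum_prod_type_right, ← hcard, ← sum_cliqueInd, Finset.sum_mul]
  refine (Finset.abs_sum_le_sum_abs _ _).trans (Finset.sum_le_sum fun c _ => ?_)
  have h1 := h.sum_abs_prod_le {i // i ∈ S} (by rwa [hcardS]) (by rwa [hcardS])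
    (b := fun w => b w (e.symm (fun _ => x₀, c))) (fun w => hb _ _)
  rw [hcardS] at h1
  refine (Finset.abs_sum_le_sum_abs _ _).trans ?_
  refine le_trans ?_ (mul_le_mul_of_nonneg_left h1 (cliqueInd_nonneg G c))
  rw [Finset.mul_sum]
  refine Finset.sum_le_sum fun a _ => ?_
  rw [abs_mul]
  have hout : (fun i : {i // i ∉ S} => e.symm (a, c) i) = c := by
    ext i; simp [e, Equiv.piEquivPiSubtypeProd, i.2]
  have hin (i : {i // i ∈ S}) : e.symm (a, c) i = a i := by
    simp [e, Equiv.piEquivPiSubtypeProd]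
  have e1 : ∑ w, b w (e.symm (a, c)) * ∏ i ∈ S, F w (e.symm (a, c) i) =
      ∑ w, b w (e.symm (fun _ => x₀, c)) * ∏ i, F w (a i) := by
    refine Finset.sum_congr rfl fun w _ => ?_
    rw [← Finset.prod_coe_sort S]
    congr 1
    · refine hbS w _ _ fun i hi => ?_
      simp [e, Equiv.piEquivPiSubtypeProd, hi]
    · exact Finset.prod_congr rfl fun i _ => by rw [hin]
  rw [e1]
  refine mul_le_mul_of_nonneg_right ?_ (abs_nonneg _)
  have := hκ (e.symm (a, c))
  rwa [hout] at this

/-- Number of ordered cliques on `t` vertices joined to both ends of a weighted pair. -/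
noncomputable def weightedExt (G : SimpleGraph V) (φ : V → V → ℝ) (t : ℕ) : ℝ :=
  ∑ x, ∑ y, φ x y * ∑ u : Fin t → V,
    cliqueInd G u * ((∏ i, adjInd G x (u i)) * ∏ i, adjInd G y (u i))

theorem sum_cliqueInd_mul_pair (t : ℕ) (h : V → V → ℝ) :
    ∑ v : Fin (t + 2) → V, cliqueInd G v * h (v 0) (v 1) =
      weightedExt G (fun x y => adjInd G x y * h x y) t := by
  rw [sum_fin_cons]
  refine Finset.sum_congr rfl fun x _ => ?_
  rw [sum_fin_cons]
  refine Finset.sum_congr rfl fun y _ => ?_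
  rw [Finset.mul_sum]
  refine Finset.sum_congr rfl fun u _ => ?_
  rw [cliqueInd_cons, cliqueInd_cons, Fin.prod_univ_succ]
  have e1 : (Fin.cons x (Fin.cons y u) : Fin (t + 2) → V) 1 = y := rfl
  simp only [Fin.cons_zero, Fin.cons_succ, e1]
  ring

theorem cliqueCount_add_two (t : ℕ) : cliqueCount G (t + 2) = weightedExt G (adjInd G) t := by
  have := sum_cliqueInd_mul_pair (G := G) t fun _ _ => 1
  simpa [cliqueCount] using this

/-- Singles out one clique vertex w, whose adjacencies to x, y and the other vertices can then be
replaced by p. -/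
theorem weightedExt_succ (φ : V → V → ℝ) (t : ℕ) :
    weightedExt G φ (t + 1) = ∑ x, ∑ y, φ x y * ∑ u : Fin t → V,
      cliqueInd G u * ((∏ i, adjInd G x (u i)) * ∏ i, adjInd G y (u i)) *
        ∑ w, adjInd G w x * adjInd G w y * ∏ i, adjInd G w (u i) := by
  unfold weightedExt
  refine Finset.sum_congr rfl fun x _ => Finset.sum_congr rfl fun y _ => ?_
  congr 1
  rw [sum_fin_cons, Finset.sum_comm]
  refine Finset.sum_congr rfl fun u _ => ?_
  rw [Finset.mul_sum]
  refine Finset.sum_congr rfl fun w _ => ?_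
  rw [cliqueInd_cons, Fin.prod_univ_succ, Fin.prod_univ_succ]
  simp only [Fin.cons_zero, Fin.cons_succ]
  rw [adjInd_comm G x w, adjInd_comm G y w]
  ring

/-- Euclidean norm of a kernel. -/
noncomputable def kernelNorm (φ : V → V → ℝ) : ℝ := √(∑ x, ∑ y, φ x y ^ 2)

theorem kernelNorm_nonneg (φ : V → V → ℝ) : 0 ≤ kernelNorm φ := Real.sqrt_nonneg _

theorem kernelNorm_swap (φ : V → V → ℝ) : kernelNorm (fun x y => φ y x) = kernelNorm φ := by
  rw [kernelNorm, Finset.sum_comm]; rfl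

theorem sum_sqrt_le (φ : V → V → ℝ) :
    ∑ y, √(∑ x, φ x y ^ 2) ≤ √(Fintype.card V) * kernelNorm φ := by
  rw [← kernelNorm_swap, kernelNorm, ← Real.sqrt_mul (by positivity)]
  refine Real.le_sqrt_of_sq_le ?_
  have := Finset.sum_mul_sq_le_sq_mul_sq Finset.univ (fun _ : V => (1 : ℝ))
    (fun y => √(∑ x, φ x y ^ 2))
  simp only [one_mul, one_pow, Finset.sum_const, Finset.card_univ, nsmul_eq_mul, mul_one] at this
  refine this.trans (le_of_eq ?_)
  congr 1
  exact Finset.sum_congr rfl fun y _ =>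
    Real.sq_sqrt (Finset.sum_nonneg fun _ _ => sq_nonneg _)

theorem sum_abs_le_kernelNorm (φ : V → V → ℝ) :
    ∑ x, ∑ y, |φ x y| ≤ Fintype.card V * kernelNorm φ := by
  have hn : (0 : ℝ) ≤ Fintype.card V := by positivity
  have h : (Fintype.card V : ℝ) * kernelNorm φ =
      √(Fintype.card V) * (√(Fintype.card V) * kernelNorm φ) := by
    rw [← mul_assoc, Real.mul_self_sqrt hn]
  rw [h]
  refine le_trans ?_ (mul_le_mul_of_nonneg_left (sum_sqrt_le φ) (Real.sqrt_nonneg _))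
  rw [Finset.sum_comm, Finset.mul_sum]
  refine Finset.sum_le_sum fun y _ => ?_
  rw [← Real.sqrt_mul hn]
  refine Real.le_sqrt_of_sq_le ?_
  have := Finset.sum_mul_sq_le_sq_mul_sq Finset.univ (fun _ : V => (1 : ℝ)) (fun x => |φ x y|)
  simpa using this

theorem abs_weightedExt_le (φ : V → V → ℝ) (t : ℕ) :
    |weightedExt G φ t| ≤ Fintype.card V * kernelNorm φ * cliqueCount G t := by
  refine le_trans ?_ (mul_le_mul_of_nonneg_right (sum_abs_le_kernelNorm φ) (cliqueCount_nonneg G t))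
  unfold weightedExt
  rw [Finset.sum_mul]
  refine (Finset.abs_sum_le_sum_abs _ _).trans (Finset.sum_le_sum fun x _ => ?_)
  rw [Finset.sum_mul]
  refine (Finset.abs_sum_le_sum_abs _ _).trans (Finset.sum_le_sum fun y _ => ?_)
  rw [abs_mul]
  refine mul_le_mul_of_nonneg_left ?_ (abs_nonneg _)
  refine (Finset.abs_sum_le_sum_abs _ _).trans (Finset.sum_le_sum fun u _ => ?_)
  have h1 := mul_nonneg (prod_adjInd_nonneg (G := G) x u) (prod_adjInd_nonneg (G := G) y u)
  rw [abs_of_nonneg (mul_nonneg (cliqueInd_nonneg G u) h1)]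
  exact mul_le_of_le_one_right (cliqueInd_nonneg G u)
    (mul_le_one₀ (prod_adjInd_le_one x u) (prod_adjInd_nonneg y u) (prod_adjInd_le_one y u))

/-- Since `b` does not involve x, for fixed y and u the sum over x is the one-variable estimate with
weight φ(x,y) times the adjacencies of x to u. Cauchy–Schwarz over y then recovers the norm of φ. -/
theorem SmallCodev.abs_sum_end_le (h : SmallCodev F σ) (φ : V → V → ℝ) (t : ℕ)
    {b : V → V → (Fin t → V) → ℝ} (hb : ∀ w y u, |b w y u| ≤ 1) :
    |∑ x, ∑ y, φ x y * ∑ u : Fin t → V,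
      cliqueInd G u * ((∏ i, adjInd G x (u i)) * ∏ i, adjInd G y (u i)) *
        ∑ w, b w y u * F w x| ≤
      2 * σ * (Fintype.card V : ℝ) ^ 2 * kernelNorm φ * cliqueCount G t := by
  have hn0 := h.card_pos
  have hσ := h.pos
  have e : ∑ x, ∑ y, φ x y * ∑ u : Fin t → V,
      cliqueInd G u * ((∏ i, adjInd G x (u i)) * ∏ i, adjInd G y (u i)) * ∑ w, b w y u * F w x =
      ∑ u : Fin t → V, ∑ y, (cliqueInd G u * ∏ i, adjInd G y (u i)) *
        ∑ x, (φ x y * ∏ i, adjInd G x (u i)) * ∑ w, b w y u * F w x := by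
    rw [Finset.sum_comm, Finset.sum_comm (s := (Finset.univ : Finset (Fin t → V)))]
    refine Finset.sum_congr rfl fun y _ => ?_
    simp_rw [Finset.mul_sum (s := (Finset.univ : Finset (Fin t → V)))]
    rw [Finset.sum_comm]
    refine Finset.sum_congr rfl fun u _ => ?_
    rw [Finset.mul_sum]
    refine Finset.sum_congr rfl fun x _ => ?_
    ring
  rw [e]
  have h3 : √(Fintype.card V : ℝ) * √(Fintype.card V : ℝ) ^ 3 = (Fintype.card V : ℝ) ^ 2 := by
    have : √(Fintype.card V : ℝ) * √(Fintype.card V : ℝ) ^ 3 =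
      (√(Fintype.card V : ℝ) ^ 2) ^ 2 := by ring
    rw [this, Real.sq_sqrt hn0.le]
  have h4 : 2 * σ * (Fintype.card V : ℝ) ^ 2 * kernelNorm φ * cliqueCount G t =
      cliqueCount G t * ((√(Fintype.card V : ℝ) * kernelNorm φ) *
        (2 * σ * √(Fintype.card V : ℝ) ^ 3)) := by
    rw [← h3]; ring
  rw [h4, cliqueCount, Finset.sum_mul]
  refine (Finset.abs_sum_le_sum_abs _ _).trans (Finset.sum_le_sum fun u _ => ?_)
  have h5 := mul_le_mul_of_nonneg_right (sum_sqrt_le φ)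
    (show 0 ≤ 2 * σ * √(Fintype.card V : ℝ) ^ 3 by positivity)
  refine le_trans ?_ (mul_le_mul_of_nonneg_left h5 (cliqueInd_nonneg G u))
  rw [Finset.sum_mul, Finset.mul_sum]
  refine (Finset.abs_sum_le_sum_abs _ _).trans (Finset.sum_le_sum fun y _ => ?_)
  rw [abs_mul]
  have h6 : |cliqueInd G u * ∏ i, adjInd G y (u i)| ≤ cliqueInd G u := by
    rw [abs_of_nonneg (mul_nonneg (cliqueInd_nonneg G u) (prod_adjInd_nonneg y u))]
    exact mul_le_of_le_one_right (cliqueInd_nonneg G u) (prod_adjInd_le_one y u)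
  refine mul_le_mul h6 ?_ (abs_nonneg _) (cliqueInd_nonneg G u)
  refine (h.abs_sum_weight_le (fun w => hb w y u) _).trans ?_
  refine mul_le_mul_of_nonneg_right (Real.sqrt_le_sqrt (Finset.sum_le_sum fun x _ => ?_))
    (by positivity)
  rw [mul_pow]
  exact mul_le_of_le_one_right (sq_nonneg _)
    (pow_le_one₀ (prod_adjInd_nonneg x u) (prod_adjInd_le_one x u))

end Cliques

/-! ### Quasirandomness: removing clique vertices one at a time -/

section Peeling

variable {V : Type*} {G : SimpleGraph V} {σ p θ : ℝ} {m : ℕ}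

/-- Telescoping: factors are replaced by p one by one, so each error term contains a single
deviation and otherwise factors in [0,1]. -/
theorem prod_adjInd_eq (p : ℝ) (t : ℕ) (w : V) (u : Fin t → V) :
    ∏ i, adjInd G w (u i) = p ^ t + ∑ i, dev G p w (u i) *
      (∏ j ∈ Finset.univ.filter (· < i), adjInd G w (u j)) *
        ∏ _j ∈ Finset.univ.filter (i < ·), p := by
  have := Finset.prod_add_ordered (Finset.univ : Finset (Fin t)) (fun _ => p)
    (fun i => dev G p w (u i))
  simp only [dev, add_sub_cancel, Finset.prod_const, Finset.card_univ, Fintype.card_fin] at this ⊢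
  rw [this]

variable [Fintype V]

theorem SmallCodev.abs_sum_inner_le (h : SmallCodev (dev G p) σ) (hp0 : 0 ≤ p) (hp1 : p ≤ 1)
    {t : ℕ} {κ : (Fin t → V) → ℝ} (hκ : ∀ u, |κ u| ≤ cliqueInd G u) :
    |∑ u, κ u * ∑ w, (∏ i, adjInd G w (u i) - p ^ t)| ≤
      t * (cliqueCount G (t - 1) * (2 * σ * (Fintype.card V : ℝ) ^ 2)) := by
  have e : ∑ u, κ u * ∑ w, (∏ i, adjInd G w (u i) - p ^ t) =
      ∑ i : Fin t, ∑ u, κ u * ∑ w, ((∏ j ∈ Finset.univ.filter (· < i), adjInd G w (u j)) *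
        ∏ j ∈ Finset.univ.filter (i < ·), p) * ∏ j ∈ ({i} : Finset (Fin t)), dev G p w (u j) := by
    rw [Finset.sum_comm]
    refine Finset.sum_congr rfl fun u _ => ?_
    rw [← Finset.mul_sum, Finset.sum_comm]
    congr 1
    refine Finset.sum_congr rfl fun w _ => ?_
    rw [prod_adjInd_eq p, add_sub_cancel_left]
    refine Finset.sum_congr rfl fun i _ => ?_
    rw [Finset.prod_singleton]
    ring
  rw [e]
  refine (Finset.abs_sum_le_sum_abs _ _).trans ?_
  refine (Finset.sum_le_sum (g := fun _ =>
    cliqueCount G (t - 1) * (2 * σ * (Fintype.card V : ℝ) ^ 2)) fun i _ => ?_).trans (by simp)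
  have h1 := h.abs_sum_split_le {i} (by simp) (by simp) (κ := κ)
    (fun v => (hκ v).trans (cliqueInd_le_comp G v Subtype.val_injective))
    (b := fun w u => (∏ j ∈ Finset.univ.filter (· < i), adjInd G w (u j)) *
        ∏ j ∈ Finset.univ.filter (i < ·), p) ?_ ?_
  · simpa using h1
  · intro w v
    have h1 : 0 ≤ ∏ j ∈ Finset.univ.filter (· < i), adjInd G w (v j) :=
      Finset.prod_nonneg fun _ _ => adjInd_nonneg G _ _
    have h2 : ∏ j ∈ Finset.univ.filter (· < i), adjInd G w (v j) ≤ 1 :=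
      Finset.prod_le_one (fun _ _ => adjInd_nonneg G _ _) fun _ _ => adjInd_le_one G _ _
    have h3 : 0 ≤ ∏ j ∈ Finset.univ.filter (i < ·), p := Finset.prod_nonneg fun _ _ => hp0
    have h4 : ∏ j ∈ Finset.univ.filter (i < ·), p ≤ 1 :=
      Finset.prod_le_one (fun _ _ => hp0) fun _ _ => hp1
    rw [abs_of_nonneg (mul_nonneg h1 h3)]
    exact mul_le_one₀ h2 h3 h4
  · intro w v v' hv
    congr 1
    refine Finset.prod_congr rfl fun j hj => ?_
    rw [hv j]
    simpa using ((Finset.mem_filter.mp hj).2).ne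

/-- Adding one vertex to the cliques multiplies weighted counts by about `n * p ^ (t + 2)`. -/
theorem SmallCodev.abs_weightedExt_succ_sub_le (h : SmallCodev (dev G p) σ) (hp0 : 0 ≤ p)
    (hp1 : p ≤ 1) (φ : V → V → ℝ) (t : ℕ) :
    |weightedExt G φ (t + 1) - Fintype.card V * p ^ (t + 2) * weightedExt G φ t| ≤
      2 * σ * kernelNorm φ * (2 * (Fintype.card V : ℝ) ^ 2 * cliqueCount G t +
        t * (Fintype.card V : ℝ) ^ 3 * cliqueCount G (t - 1)) := by
  set n : ℝ := (Fintype.card V : ℝ) with hn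
  have hn0 : 0 < n := h.card_pos
  let W : V → V → (Fin t → V) → ℝ := fun x y u =>
    cliqueInd G u * ((∏ i, adjInd G x (u i)) * ∏ i, adjInd G y (u i))
  have hP (w : V) (u : Fin t → V) : 0 ≤ ∏ i, adjInd G w (u i) := prod_adjInd_nonneg w u
  have hP1 (w : V) (u : Fin t → V) : ∏ i, adjInd G w (u i) ≤ 1 := prod_adjInd_le_one w u
  -- Replacing by p first A(w,x), then A(w,y), then the adjacencies to u leaves the errors `E1`,
  -- `E2`, `E3`. In `E2` the names x and y are exchanged, so that the same end estimate applies to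
  -- the transposed weight.
  set E1 : ℝ := ∑ x, ∑ y, φ x y * ∑ u, W x y u *
    ∑ w, (adjInd G w y * ∏ i, adjInd G w (u i)) * dev G p w x with hE1
  set E2 : ℝ := ∑ x, ∑ y, φ y x * ∑ u, W x y u *
    ∑ w, (p * ∏ i, adjInd G w (u i)) * dev G p w x with hE2
  set E3 : ℝ := ∑ x, ∑ y, φ x y * ∑ u, W x y u *
    ∑ w, (∏ i, adjInd G w (u i) - p ^ t) with hE3
  have e : weightedExt G φ (t + 1) - n * p ^ (t + 2) * weightedExt G φ t = E1 + E2 + p ^ 2 * E3 := by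
    have e2 : E2 = ∑ x, ∑ y, φ x y * ∑ u, W x y u *
        ∑ w, (p * ∏ i, adjInd G w (u i)) * dev G p w y := by
      rw [hE2, Finset.sum_comm]
      refine Finset.sum_congr rfl fun x _ => Finset.sum_congr rfl fun y _ => ?_
      congr 1
      refine Finset.sum_congr rfl fun u _ => ?_
      simp only [W]
      rw [mul_comm (∏ i, adjInd G y (u i))]
    rw [weightedExt_succ, weightedExt, e2, hE1, hE3]
    simp_rw [Finset.mul_sum (s := (Finset.univ : Finset V)), ← Finset.sum_add_distrib,
      ← Finset.sum_sub_distrib]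
    refine Finset.sum_congr rfl fun x _ => Finset.sum_congr rfl fun y _ => ?_
    simp_rw [← Finset.mul_sum (s := (Finset.univ : Finset V))]
    have key : ∑ u, W x y u * ∑ w, adjInd G w x * adjInd G w y * ∏ i, adjInd G w (u i) =
        n * p ^ (t + 2) * ∑ u, W x y u +
        ∑ u, W x y u * ∑ w, (adjInd G w y * ∏ i, adjInd G w (u i)) * dev G p w x +
        ∑ u, W x y u * ∑ w, (p * ∏ i, adjInd G w (u i)) * dev G p w y +
        p ^ 2 * ∑ u, W x y u * ∑ w, (∏ i, adjInd G w (u i) - p ^ t) := by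
      rw [Finset.mul_sum, Finset.mul_sum, ← Finset.sum_add_distrib, ← Finset.sum_add_distrib,
        ← Finset.sum_add_distrib]
      refine Finset.sum_congr rfl fun u _ => ?_
      have : ∑ w, adjInd G w x * adjInd G w y * ∏ i, adjInd G w (u i) = n * p ^ (t + 2) +
          ∑ w, (adjInd G w y * ∏ i, adjInd G w (u i)) * dev G p w x +
          ∑ w, (p * ∏ i, adjInd G w (u i)) * dev G p w y +
          p ^ 2 * ∑ w, (∏ i, adjInd G w (u i) - p ^ t) := by
        have hc : n * p ^ (t + 2) = ∑ _w : V, p ^ (t + 2) := by simp [hn]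
        rw [hc, Finset.mul_sum, ← Finset.sum_add_distrib, ← Finset.sum_add_distrib,
          ← Finset.sum_add_distrib]
        refine Finset.sum_congr rfl fun w _ => ?_
        simp only [dev]
        ring
      rw [this]
      ring
    change φ x y * ∑ u, W x y u * _ - n * p ^ (t + 2) * (φ x y * ∑ u, W x y u) = _
    rw [key]
    ring
  have b1 : |E1| ≤ 2 * σ * n ^ 2 * kernelNorm φ * cliqueCount G t := by
    refine h.abs_sum_end_le φ t fun w y u => ?_
    rw [abs_of_nonneg (mul_nonneg (adjInd_nonneg G _ _) (hP w u))]
    exact mul_le_one₀ (adjInd_le_one G _ _) (hP w u) (hP1 w u)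
  have b2 : |E2| ≤ 2 * σ * n ^ 2 * kernelNorm φ * cliqueCount G t := by
    rw [← kernelNorm_swap φ]
    refine h.abs_sum_end_le (fun x y => φ y x) t fun w y u => ?_
    rw [abs_of_nonneg (mul_nonneg hp0 (hP w u))]
    exact mul_le_one₀ hp1 (hP w u) (hP1 w u)
  have b3 : |E3| ≤ (n * kernelNorm φ) * (t * (cliqueCount G (t - 1) * (2 * σ * n ^ 2))) := by
    have hnn : 0 ≤ t * (cliqueCount G (t - 1) * (2 * σ * n ^ 2)) := by
      have := cliqueCount_nonneg G (t - 1)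
      have := h.pos
      positivity
    refine le_trans ?_ (mul_le_mul_of_nonneg_right (sum_abs_le_kernelNorm φ) hnn)
    rw [Finset.sum_mul]
    refine (Finset.abs_sum_le_sum_abs _ _).trans (Finset.sum_le_sum fun x _ => ?_)
    rw [Finset.sum_mul]
    refine (Finset.abs_sum_le_sum_abs _ _).trans (Finset.sum_le_sum fun y _ => ?_)
    rw [abs_mul]
    refine mul_le_mul_of_nonneg_left (h.abs_sum_inner_le hp0 hp1 fun u => ?_) (abs_nonneg _)
    have h1 := mul_nonneg (hP x u) (hP y u)
    rw [abs_of_nonneg (mul_nonneg (cliqueInd_nonneg G u) h1)]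
    exact mul_le_of_le_one_right (cliqueInd_nonneg G u) (mul_le_one₀ (hP1 x u) (hP y u) (hP1 y u))
  rw [e]
  have hp2 : p ^ 2 ≤ 1 := pow_le_one₀ hp0 hp1
  have b4 : |p ^ 2 * E3| ≤ |E3| := by
    rw [abs_mul, abs_of_nonneg (sq_nonneg p)]
    exact mul_le_of_le_one_left (abs_nonneg _) hp2
  have b5 := (abs_add_le (E1 + E2) (p ^ 2 * E3)).trans (add_le_add_left (abs_add_le E1 E2) _)
  have e5 : 2 * σ * kernelNorm φ * (2 * n ^ 2 * cliqueCount G t +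
      t * n ^ 3 * cliqueCount G (t - 1)) =
      2 * σ * n ^ 2 * kernelNorm φ * cliqueCount G t + 2 * σ * n ^ 2 * kernelNorm φ * cliqueCount G t
      + (n * kernelNorm φ) * (t * (cliqueCount G (t - 1) * (2 * σ * n ^ 2))) := by ring
  rw [e5]
  linarith

/-- `F = dev G p` has small row sums and codegree deviations, on a scale at which cliques with at
most `m` vertices are still counted accurately. -/
structure Quasirandom (G : SimpleGraph V) (p σ θ : ℝ) (m : ℕ) : Prop where
  small : SmallCodev (dev G p) σ
  nonneg : 0 ≤ p
  le_one : p ≤ 1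
  theta_pos : 0 < θ
  theta_le : 2 * θ ≤ p ^ m
  sigma_le : 2 * m * σ ≤ θ ^ 4
  two_le : 2 ≤ m
  row_le : ∀ u, |∑ w, dev G p u w| ≤ σ ^ 2 * Fintype.card V

theorem Quasirandom.theta_le_pow (h : Quasirandom G p σ θ m) {s : ℕ} (hs : s ≤ m) :
    2 * θ ≤ p ^ s :=
  h.theta_le.trans (pow_le_pow_of_le_one h.nonneg h.le_one hs)

theorem Quasirandom.two_theta_le (h : Quasirandom G p σ θ m) : 2 * θ ≤ p := by
  simpa using h.theta_le_pow (s := 1) (by linarith [h.two_le])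

theorem Quasirandom.theta_le_one (h : Quasirandom G p σ θ m) : θ ≤ 1 := by
  linarith [h.two_theta_le, h.le_one, h.theta_pos]

theorem Quasirandom.sigma_le_theta (h : Quasirandom G p σ θ m) : 4 * σ ≤ θ ^ 4 := by
  have h1 : (2 : ℝ) ≤ m := by exact_mod_cast h.two_le
  nlinarith [h.sigma_le, h.small.pos]

theorem sum_adjInd (p : ℝ) (u : V) :
    ∑ w, adjInd G u w = Fintype.card V * p + ∑ w, dev G p u w := by
  simp [dev, Finset.sum_sub_distrib]

theorem kernelNorm_le_of_abs_le_one {φ : V → V → ℝ} (hφ : ∀ x y, |φ x y| ≤ 1) :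
    kernelNorm φ ≤ Fintype.card V := by
  refine Real.sqrt_le_iff.mpr ⟨by positivity, ?_⟩
  refine (Finset.sum_le_sum fun x _ => Finset.sum_le_sum (g := fun _ => (1 : ℝ)) fun y _ => ?_).trans
    (by simp [sq])
  rw [← sq_abs]
  exact pow_le_one₀ (abs_nonneg _) (hφ x y)

theorem kernelNorm_adjInd_le : kernelNorm (adjInd G) ≤ Fintype.card V :=
  kernelNorm_le_of_abs_le_one fun x y => by
    rw [abs_of_nonneg (adjInd_nonneg G _ _)]; exact adjInd_le_one G _ _

/-- Each factor n in front of a smaller clique count is traded for θ⁻¹ and one more clique vertex.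
The growth of clique counts is a hypothesis because this bound is itself used to prove that growth
by induction. -/
theorem Quasirandom.peel_error_le (h : Quasirandom G p σ θ m) {t : ℕ} (φ : V → V → ℝ)
    (hX : ∀ s < t + 2, θ * Fintype.card V * cliqueCount G s ≤ cliqueCount G (s + 1)) :
    |weightedExt G φ (t + 1) - Fintype.card V * p ^ (t + 2) * weightedExt G φ t| ≤
      2 * σ * (t + 2) * θ⁻¹ ^ 3 * kernelNorm φ * cliqueCount G (t + 2) := by
  refine (h.small.abs_weightedExt_succ_sub_le h.nonneg h.le_one φ t).trans ?_
  set n : ℝ := (Fintype.card V : ℝ) with hn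
  have hn0 : 0 < n := h.small.card_pos
  have hθ := h.theta_pos
  have hσ := h.small.pos
  have hi : 1 ≤ θ⁻¹ := (one_le_inv₀ hθ).mpr h.theta_le_one
  have hi0 : 0 < θ⁻¹ := by positivity
  have hK := kernelNorm_nonneg φ
  have step (s : ℕ) (hs : s < t + 2) : n * cliqueCount G s ≤ θ⁻¹ * cliqueCount G (s + 1) := by
    rw [← div_eq_inv_mul, le_div_iff₀ hθ]
    linarith [hX s hs]
  have h1 : n ^ 2 * cliqueCount G t ≤ θ⁻¹ ^ 2 * cliqueCount G (t + 2) := by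
    calc n ^ 2 * cliqueCount G t = n * (n * cliqueCount G t) := by ring
      _ ≤ n * (θ⁻¹ * cliqueCount G (t + 1)) :=
        mul_le_mul_of_nonneg_left (step t (by omega)) (by positivity)
      _ = θ⁻¹ * (n * cliqueCount G (t + 1)) := by ring
      _ ≤ θ⁻¹ * (θ⁻¹ * cliqueCount G (t + 2)) :=
        mul_le_mul_of_nonneg_left (step (t + 1) (by omega)) (by positivity)
      _ = _ := by ring
  have hX0 := cliqueCount_nonneg G (t + 2)
  have h2 : n ^ 2 * cliqueCount G t ≤ θ⁻¹ ^ 3 * cliqueCount G (t + 2) :=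
    h1.trans (by gcongr; norm_num)
  have h3 : t * n ^ 3 * cliqueCount G (t - 1) ≤ t * (θ⁻¹ ^ 3 * cliqueCount G (t + 2)) := by
    rcases t with _ | t
    · simp
    · rw [mul_assoc]
      refine mul_le_mul_of_nonneg_left ?_ (by positivity)
      simp only [Nat.add_sub_cancel]
      calc n ^ 3 * cliqueCount G t = n ^ 2 * (n * cliqueCount G t) := by ring
        _ ≤ n ^ 2 * (θ⁻¹ * cliqueCount G (t + 1)) :=
        mul_le_mul_of_nonneg_left (step t (by omega)) (by positivity)
        _ = θ⁻¹ * (n ^ 2 * cliqueCount G (t + 1)) := by ring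
        _ ≤ θ⁻¹ * (θ⁻¹ ^ 2 * cliqueCount G (t + 1 + 2)) := by gcongr
        _ = _ := by ring
  calc 2 * σ * kernelNorm φ * (2 * n ^ 2 * cliqueCount G t + t * n ^ 3 * cliqueCount G (t - 1))
      ≤ 2 * σ * kernelNorm φ * (2 * (θ⁻¹ ^ 3 * cliqueCount G (t + 2)) +
          t * (θ⁻¹ ^ 3 * cliqueCount G (t + 2))) := by
        refine mul_le_mul_of_nonneg_left ?_ (by positivity)
        linarith
    _ = _ := by ring

/-- In the recursion with weight `adjInd G`, the main factor n·p^s is at least 2θn, and the choice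
of σ keeps the error below θn. The sizes 0 and 1 are below the range of the recursion; size 1 uses
the row sums. -/
theorem Quasirandom.le_cliqueCount_succ (h : Quasirandom G p σ θ m) {s : ℕ} (hs : s < m) :
    θ * Fintype.card V * cliqueCount G s ≤ cliqueCount G (s + 1) := by
  induction s using Nat.strong_induction_on with
  | _ s ih =>
    set n : ℝ := (Fintype.card V : ℝ) with hn
    have hn0 : 0 < n := h.small.card_pos
    have hθ := h.theta_pos
    have hσ := h.small.pos
    have hθ1 := h.theta_le_one
    rcases s with _ | _ | t
    · rw [cliqueCount_zero, zero_add, cliqueCount_one]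
      nlinarith
    · rw [zero_add, cliqueCount_one, cliqueCount_succ]
      have e : ∑ v : Fin 1 → V, cliqueInd G v * ∑ w, ∏ i, adjInd G w (v i) =
          ∑ u, ∑ w, adjInd G u w := by
        rw [← (Equiv.funUnique (Fin 1) V).symm.sum_comp]
        refine Finset.sum_congr rfl fun u _ => ?_
        simp [cliqueInd, adjInd_comm G u, Subsingleton.pairwise]
      rw [e]
      have : ∑ _u : V, θ * n ≤ ∑ u, ∑ w, adjInd G u w := by
        refine Finset.sum_le_sum fun u _ => ?_
        rw [sum_adjInd p]
        have h1 := (abs_le.mp (h.row_le u)).1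
        have h2 : σ ^ 2 ≤ θ := by
          have h3 := h.sigma_le_theta
          have h4 : θ ^ 4 ≤ θ := pow_le_of_le_one hθ.le hθ1 (by norm_num)
          nlinarith [h.small.le_one]
        nlinarith [h.two_theta_le]
      refine le_trans (le_of_eq ?_) this
      simp [hn]
      ring
    · have hpe := h.peel_error_le (t := t) (adjInd G) fun j hj => ih j hj (by omega)
      rw [← cliqueCount_add_two, ← cliqueCount_add_two] at hpe
      have hX0 := cliqueCount_nonneg G (t + 2)
      have h1 : 2 * σ * (t + 2) * θ⁻¹ ^ 3 * kernelNorm (adjInd G) ≤ θ * n := by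
        have h2 : 2 * σ * (t + 2) * θ⁻¹ ^ 3 ≤ θ := by
          have h3 : (t : ℝ) + 2 ≤ m := by exact_mod_cast hs.le
          have h4 : 2 * σ * (t + 2) ≤ θ ^ 4 := by nlinarith [h.sigma_le]
          calc 2 * σ * (t + 2) * θ⁻¹ ^ 3 ≤ θ ^ 4 * θ⁻¹ ^ 3 := by gcongr
            _ = θ := by field_simp
        exact mul_le_mul h2 kernelNorm_adjInd_le (kernelNorm_nonneg _) hθ.le
      have h5 := (abs_le.mp hpe).1
      have h6 := mul_le_mul_of_nonneg_right h1 hX0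
      have h7 := mul_le_mul_of_nonneg_right
        (mul_le_mul_of_nonneg_left (h.theta_le_pow (s := t + 2) hs.le) hn0.le) hX0
      have e1 : t + 1 + 2 = t + 2 + 1 := by omega
      rw [e1] at h5
      have e2 : t + 1 + 1 = t + 2 := by omega
      rw [e2]
      linarith

theorem Quasirandom.cliqueCount_pos (h : Quasirandom G p σ θ m) {s : ℕ} (hs : s ≤ m) :
    0 < cliqueCount G s := by
  have hn0 := h.small.card_pos
  have hθ := h.theta_pos
  induction s with
  | zero => rw [cliqueCount_zero]; exact one_pos
  | succ s ih =>
    have := ih (by omega)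
    exact lt_of_lt_of_le (by positivity) (h.le_cliqueCount_succ (Nat.lt_of_succ_le hs))

theorem Quasirandom.pow_mul_cliqueCount_le (h : Quasirandom G p σ θ m) {s : ℕ} (j : ℕ)
    (hs : s + j ≤ m) :
    (Fintype.card V : ℝ) ^ j * cliqueCount G s ≤ θ⁻¹ ^ j * cliqueCount G (s + j) := by
  have hn0 := h.small.card_pos
  have hθ := h.theta_pos
  induction j with
  | zero => simp
  | succ j ih =>
    calc (Fintype.card V : ℝ) ^ (j + 1) * cliqueCount G s
        = Fintype.card V * ((Fintype.card V : ℝ) ^ j * cliqueCount G s) := by ring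
      _ ≤ Fintype.card V * (θ⁻¹ ^ j * cliqueCount G (s + j)) :=
        mul_le_mul_of_nonneg_left (ih (by omega)) hn0.le
      _ = θ⁻¹ ^ (j + 1) * (θ * Fintype.card V * cliqueCount G (s + j)) := by
        rw [pow_succ]
        field_simp
      _ ≤ θ⁻¹ ^ (j + 1) * cliqueCount G (s + j + 1) := by
        gcongr
        exact h.le_cliqueCount_succ (by omega)

/-- The average of a kernel over the first edge of a clique hardly depends on the clique size. -/
theorem Quasirandom.abs_ratio_sub_le (h : Quasirandom G p σ θ m) (φ : V → V → ℝ) {t : ℕ}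
    (ht : t + 3 ≤ m) :
    |weightedExt G φ (t + 1) / cliqueCount G (t + 3) -
      weightedExt G φ t / cliqueCount G (t + 2)| ≤
      4 * σ * m * θ⁻¹ ^ 6 * (kernelNorm φ / Fintype.card V) := by
  set n : ℝ := (Fintype.card V : ℝ) with hn
  have hn0 : 0 < n := h.small.card_pos
  have hθ := h.theta_pos
  have hσ := h.small.pos
  have hi : 1 ≤ θ⁻¹ := (one_le_inv₀ hθ).mpr h.theta_le_one
  have hK := kernelNorm_nonneg φ
  have hXs : ∀ s < t + 2, θ * n * cliqueCount G s ≤ cliqueCount G (s + 1) :=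
    fun s hs => h.le_cliqueCount_succ (by omega)
  have p1 := h.peel_error_le (t := t) φ hXs
  have p2 := h.peel_error_le (t := t) (adjInd G) hXs
  rw [← cliqueCount_add_two, ← cliqueCount_add_two] at p2
  have e1 : t + 1 + 2 = t + 3 := by omega
  rw [e1] at p2
  have hX2 := h.cliqueCount_pos (s := t + 2) (by omega)
  have hX3 := h.cliqueCount_pos (s := t + 3) (by omega)
  have hY : |weightedExt G φ t| ≤ kernelNorm φ / n * θ⁻¹ ^ 2 * cliqueCount G (t + 2) := by
    refine (abs_weightedExt_le φ t).trans ?_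
    have := h.pow_mul_cliqueCount_le (s := t) 2 (by omega)
    calc n * kernelNorm φ * cliqueCount G t = kernelNorm φ / n * (n ^ 2 * cliqueCount G t) := by
          field_simp
      _ ≤ kernelNorm φ / n * (θ⁻¹ ^ 2 * cliqueCount G (t + 2)) := by gcongr
      _ = _ := by ring
  set A := weightedExt G φ (t + 1)
  set B := weightedExt G φ t
  set X2 := cliqueCount G (t + 2)
  set X3 := cliqueCount G (t + 3)
  -- Numerator and denominator obey the same approximate recursion with factor n·p^(t+2), so the
  -- main terms cancel and only the two errors remain.
  have e : A / X3 - B / X2 =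
      ((A - n * p ^ (t + 2) * B) - B / X2 * (X3 - n * p ^ (t + 2) * X2)) / X3 := by
    field_simp
    ring
  have hm : (t : ℝ) + 2 ≤ m := by exact_mod_cast (show t + 2 ≤ m by omega)
  have hBX : |B / X2| ≤ kernelNorm φ / n * θ⁻¹ ^ 2 := by
    rw [abs_div, abs_of_pos hX2, div_le_iff₀ hX2]
    exact hY
  have q2 : |X3 - n * p ^ (t + 2) * X2| ≤ 2 * σ * m * θ⁻¹ ^ 3 * n * X2 := by
    refine p2.trans ?_
    have hK' := kernelNorm_nonneg (adjInd G)
    gcongr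
    exact kernelNorm_adjInd_le
  have q1 : |A - n * p ^ (t + 2) * B| ≤ 2 * σ * m * θ⁻¹ ^ 3 * kernelNorm φ * X2 := by
    refine p1.trans ?_
    gcongr
  have q3 : |(A - n * p ^ (t + 2) * B) - B / X2 * (X3 - n * p ^ (t + 2) * X2)| ≤
      4 * σ * m * θ⁻¹ ^ 5 * kernelNorm φ * X2 := by
    refine (abs_sub _ _).trans ?_
    rw [abs_mul]
    have q4 : |B / X2| * |X3 - n * p ^ (t + 2) * X2| ≤
        (kernelNorm φ / n * θ⁻¹ ^ 2) * (2 * σ * m * θ⁻¹ ^ 3 * n * X2) :=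
      mul_le_mul hBX q2 (abs_nonneg _) (by positivity)
    have q5 : (kernelNorm φ / n * θ⁻¹ ^ 2) * (2 * σ * m * θ⁻¹ ^ 3 * n * X2) =
        2 * σ * m * θ⁻¹ ^ 5 * kernelNorm φ * X2 := by
      rw [div_mul_eq_mul_div, div_mul_eq_mul_div, div_eq_iff hn0.ne']
      ring
    have q6 : 2 * σ * m * θ⁻¹ ^ 3 * kernelNorm φ * X2 ≤ 2 * σ * m * θ⁻¹ ^ 5 * kernelNorm φ * X2 := by
      gcongr
      norm_num
    linarith
  rw [e, abs_div, abs_of_pos hX3, div_le_iff₀ hX3]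
  refine q3.trans ?_
  have q7 : X2 ≤ θ⁻¹ / n * X3 := by
    have := h.le_cliqueCount_succ (s := t + 2) (by omega)
    rw [div_mul_eq_mul_div, le_div_iff₀ hn0, ← div_eq_inv_mul, le_div_iff₀ hθ]
    calc X2 * n * θ = θ * n * X2 := by ring
      _ ≤ X3 := this
  calc 4 * σ * m * θ⁻¹ ^ 5 * kernelNorm φ * X2
      ≤ 4 * σ * m * θ⁻¹ ^ 5 * kernelNorm φ * (θ⁻¹ / n * X3) := by gcongr
    _ = _ := by ring

theorem Quasirandom.abs_ratio_sub_zero_le (h : Quasirandom G p σ θ m) (φ : V → V → ℝ) {t : ℕ}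
    (ht : t + 2 ≤ m) :
    |weightedExt G φ t / cliqueCount G (t + 2) - weightedExt G φ 0 / cliqueCount G 2| ≤
      t * (4 * σ * m * θ⁻¹ ^ 6 * (kernelNorm φ / Fintype.card V)) := by
  induction t with
  | zero => simp
  | succ t ih =>
    have h1 := h.abs_ratio_sub_le φ (t := t) (by omega)
    have h2 := ih (by omega)
    have h3 := abs_sub_le (weightedExt G φ (t + 1) / cliqueCount G (t + 3))
      (weightedExt G φ t / cliqueCount G (t + 2)) (weightedExt G φ 0 / cliqueCount G 2)
    push_cast
    have e1 : t + 1 + 2 = t + 3 := by omega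
    rw [e1]
    linarith

end Peeling

/-! ### Third-order expansion of a product -/

section Expansion
theorem sum_powersetCard_insert {ι : Type*} [DecidableEq ι] {a : ι} {I : Finset ι} (ha : a ∉ I)
    (d : ℕ) (f : Finset ι → ℝ) :
    ∑ S ∈ powersetCard (d + 1) (insert a I), f S =
      ∑ S ∈ powersetCard (d + 1) I, f S + ∑ S ∈ powersetCard d I, f (insert a S) := by
  rw [powersetCard_succ_insert ha, sum_union, sum_image]
  · intro S hS T hT hST
    have h1 : a ∉ S := fun h => ha ((mem_powersetCard.mp hS).1 h)
    have h2 : a ∉ T := fun h => ha ((mem_powersetCard.mp hT).1 h)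
    rw [← erase_insert h1, ← erase_insert h2]
    exact congrArg (fun U => U.erase a) hST
  · rw [disjoint_left]
    intro S hS hS'
    obtain ⟨T, -, rfl⟩ := mem_image.mp hS'
    exact ha ((mem_powersetCard.mp hS).1 (mem_insert_self a T))

theorem sum_powersetCard_two {ι : Type*} [DecidableEq ι] (I : Finset ι) (y : ι → ℝ) :
    ∑ S ∈ powersetCard 2 I, ∏ i ∈ S, y i = ((∑ i ∈ I, y i) ^ 2 - ∑ i ∈ I, y i ^ 2) / 2 := by
  induction I using Finset.induction_on with
  | empty =>
    have : powersetCard 2 (∅ : Finset ι) = ∅ := powersetCard_eq_empty.2 (by simp)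
    simp [this]
  | insert a I ha ih =>
    rw [sum_powersetCard_insert ha, ih, sum_insert ha, sum_insert ha]
    have : ∑ S ∈ powersetCard 1 I, ∏ i ∈ insert a S, y i = y a * ∑ i ∈ I, y i := by
      rw [powersetCard_one, sum_map, mul_sum]
      refine sum_congr rfl fun i hi => ?_
      have : a ≠ i := fun h => ha (h ▸ hi)
      simp [prod_insert, this]
    rw [this]
    ring

/-- Monomials of degree at least 3 are grouped by their three smallest indices `S`; the later
indices recombine into full factors 1 + y. There are thus only cubically many remainder terms, each
with exactly three deviations, an odd number as the moment bounds require. -/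
theorem prod_one_add_eq {ι : Type*} [LinearOrder ι] (I : Finset ι) (y : ι → ℝ) :
    ∏ i ∈ I, (1 + y i) = 1 + ∑ i ∈ I, y i + ((∑ i ∈ I, y i) ^ 2 - ∑ i ∈ I, y i ^ 2) / 2 +
      ∑ S ∈ powersetCard 3 I, (∏ i ∈ S, y i) * ∏ a ∈ I.filter (fun a => ∀ s ∈ S, s < a), (1 + y a) := by
  induction I using Finset.induction_on_max with
  | empty =>
    have : powersetCard 3 (∅ : Finset ι) = ∅ := powersetCard_eq_empty.2 (by simp)
    simp [this]
  | insert a I hI ih =>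
    have ha : a ∉ I := fun h => lt_irrefl _ (hI a h)
    rw [prod_insert ha, ih, sum_powersetCard_insert ha, sum_insert ha, sum_insert ha]
    have h1 : ∑ S ∈ powersetCard 3 I, (∏ i ∈ S, y i) *
        ∏ b ∈ (insert a I).filter (fun b => ∀ s ∈ S, s < b), (1 + y b) = (1 + y a) *
        ∑ S ∈ powersetCard 3 I, (∏ i ∈ S, y i) *
          ∏ b ∈ I.filter (fun b => ∀ s ∈ S, s < b), (1 + y b) := by
      rw [mul_sum]
      refine sum_congr rfl fun S hS => ?_
      have hSI := (mem_powersetCard.mp hS).1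
      rw [filter_insert, if_pos fun s hs => hI s (hSI hs), prod_insert (by simp [ha])]
      ring
    have h2 : ∑ S ∈ powersetCard 2 I, (∏ i ∈ insert a S, y i) *
        ∏ b ∈ (insert a I).filter (fun b => ∀ s ∈ insert a S, s < b), (1 + y b) =
        y a * ∑ S ∈ powersetCard 2 I, ∏ i ∈ S, y i := by
      rw [mul_sum]
      refine sum_congr rfl fun S hS => ?_
      have hSI := (mem_powersetCard.mp hS).1
      have : (insert a I).filter (fun b => ∀ s ∈ insert a S, s < b) = ∅ := by
        refine filter_eq_empty_iff.mpr fun b hb hlt => ?_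
        have hab := hlt a (mem_insert_self a S)
        rcases mem_insert.mp hb with rfl | hb
        · exact lt_irrefl _ hab
        · exact lt_asymm hab (hI b hb)
      rw [this, prod_empty, mul_one, prod_insert fun h => ha (hSI h)]
    rw [h1, h2, sum_powersetCard_two]
    ring

end Expansion

/-! ### Upper bound for the total pair weight of the edges -/

section EdgeBound

variable {V : Type*} [Fintype V] {G : SimpleGraph V} {σ p θ : ℝ} {m : ℕ}

theorem sum_cliqueInd_mul_eq_of_ne {t : ℕ} (f : V → V → ℝ) {i j : Fin (t + 2)} (hij : i ≠ j) :
    ∑ v : Fin (t + 2) → V, cliqueInd G v * f (v i) (v j) =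
      ∑ v : Fin (t + 2) → V, cliqueInd G v * f (v 0) (v 1) := by
  have h01 : (0 : Fin (t + 2)) ≠ 1 := by simp
  set j' := Equiv.swap 0 i j with hj'
  have hj0 : j' ≠ 0 := by
    intro h
    rw [hj', Equiv.swap_apply_eq_iff, Equiv.swap_apply_left] at h
    exact hij h.symm
  let e : Equiv.Perm (Fin (t + 2)) := (Equiv.swap 1 j').trans (Equiv.swap 0 i)
  have e0 : e 0 = i := by
    simp [e, Equiv.swap_apply_of_ne_of_ne h01 hj0.symm]
  have e1 : e 1 = j := by simp [e, hj']
  rw [← (e.arrowCongr (Equiv.refl V)).sum_comp]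
  refine Finset.sum_congr rfl fun v _ => ?_
  have hv : (e.arrowCongr (Equiv.refl V)) v = v ∘ e.symm := rfl
  rw [hv, cliqueInd_comp_equiv]
  simp only [Function.comp_apply, ← e0, ← e1, Equiv.symm_apply_apply]

/-- Weight of a pair, collecting the linear and quadratic terms of a common neighbourhood. -/
noncomputable def pairWeight (G : SimpleGraph V) (p : ℝ) (m : ℕ) (x y : V) : ℝ :=
  2 * (∑ w, dev G p x w) / (p * (m - 1)) + codev (dev G p) x y / p ^ 2

/-- Third-order remainder of the size of a common neighbourhood. -/
noncomputable def cubicRem (G : SimpleGraph V) (p : ℝ) {m : ℕ} (v : Fin m → V) : ℝ :=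
  ∑ S ∈ powersetCard 3 (Finset.univ : Finset (Fin m)), ∑ w, (∏ i ∈ S, dev G p w (v i) / p) *
    ∏ a ∈ Finset.univ.filter (fun a => ∀ s ∈ S, s < a), (adjInd G w (v a) / p)

/-- The linear term of each vertex is shared equally among the m-1 ordered pairs that start at it;
this is the source of the factor m-1 in `pairWeight`. The division by 2 comes from the quadratic
term, where each unordered pair is met twice. -/
theorem sum_prod_adjInd_eq (hp : 0 < p) (hm : 2 ≤ m) (v : Fin m → V) :
    ∑ w, ∏ i, adjInd G w (v i) = p ^ m * (Fintype.card V +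
      ∑ i, ∑ j ∈ Finset.univ.erase i, pairWeight G p m (v i) (v j) / 2 + cubicRem G p v) := by
  have hg (w : V) (i : Fin m) : 1 + dev G p w (v i) / p = adjInd G w (v i) / p := by
    rw [dev]; field_simp; ring
  have h1 (w : V) : ∏ i, adjInd G w (v i) = p ^ m * ∏ i, (1 + dev G p w (v i) / p) := by
    simp_rw [hg, Finset.prod_div_distrib]
    simp only [Finset.prod_const, Finset.card_univ, Fintype.card_fin]
    field_simp
  simp_rw [h1]
  rw [← Finset.mul_sum]
  congr 1
  rw [Finset.sum_congr rfl fun w _ => prod_one_add_eq Finset.univ fun i => dev G p w (v i) / p]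
  simp_rw [hg]
  rw [Finset.sum_add_distrib, Finset.sum_add_distrib, Finset.sum_add_distrib, cubicRem,
    Finset.sum_comm (s := powersetCard 3 _)]
  congr 1
  swap
  · refine Finset.sum_congr rfl fun w _ => Finset.sum_congr rfl fun S _ => ?_
    congr!
  rw [add_assoc]
  congr 1
  · simp
  have hm1 : (0 : ℝ) < (m : ℝ) - 1 := by
    have : (2 : ℝ) ≤ m := by exact_mod_cast hm
    linarith
  have hD : ∑ w, ∑ i, dev G p w (v i) / p =
      ∑ i, ∑ j ∈ Finset.univ.erase i, (∑ w, dev G p (v i) w) / (p * (m - 1)) := by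
    rw [Finset.sum_comm]
    refine Finset.sum_congr rfl fun i _ => ?_
    rw [Finset.sum_const, Finset.card_erase_of_mem (Finset.mem_univ i), Finset.card_univ,
      Fintype.card_fin, nsmul_eq_mul, Nat.cast_sub (by omega), ← Finset.sum_div]
    simp_rw [dev_comm G p _ (v i)]
    push_cast
    field_simp
  have hN : ∑ w, ((∑ i, dev G p w (v i) / p) ^ 2 - ∑ i, (dev G p w (v i) / p) ^ 2) / 2 =
      ∑ i, ∑ j ∈ Finset.univ.erase i, codev (dev G p) (v i) (v j) / p ^ 2 / 2 := by
    have hc (i j : Fin m) : codev (dev G p) (v i) (v j) / p ^ 2 / 2 =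
        ∑ w, (dev G p w (v i) / p) * (dev G p w (v j) / p) / 2 := by
      rw [codev, Finset.sum_div, Finset.sum_div]
      refine Finset.sum_congr rfl fun w _ => ?_
      rw [dev_comm G p w, dev_comm G p w]
      ring
    simp_rw [hc]
    have h3 (i : Fin m) : ∑ j ∈ Finset.univ.erase i,
        ∑ w, (dev G p w (v i) / p) * (dev G p w (v j) / p) / 2 =
        ∑ w, ∑ j ∈ Finset.univ.erase i, (dev G p w (v i) / p) * (dev G p w (v j) / p) / 2 :=
      Finset.sum_comm
    simp_rw [h3]
    rw [Finset.sum_comm]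
    refine Finset.sum_congr rfl fun w _ => ?_
    rw [sq, Finset.sum_mul_sum, ← Finset.sum_sub_distrib, Finset.sum_div]
    refine Finset.sum_congr rfl fun i _ => ?_
    rw [← Finset.add_sum_erase _ _ (Finset.mem_univ i), ← Finset.sum_div]
    ring
  rw [hD, hN, ← Finset.sum_add_distrib]
  refine Finset.sum_congr rfl fun i _ => ?_
  rw [← Finset.sum_add_distrib]
  refine Finset.sum_congr rfl fun j _ => ?_
  rw [pairWeight]
  ring

theorem Quasirandom.abs_sum_cubicRem_le (h : Quasirandom G p σ θ m) :
    |∑ v : Fin m → V, cliqueInd G v * cubicRem G p v| ≤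
      2 * m ^ 3 * σ ^ 3 * θ⁻¹ ^ 7 * Fintype.card V * cliqueCount G m := by
  set n : ℝ := (Fintype.card V : ℝ) with hn
  have hn0 : 0 < n := h.small.card_pos
  have hθ := h.theta_pos
  have hσ := h.small.pos
  have hp : 0 < p := by linarith [h.two_theta_le]
  have hX := h.cliqueCount_pos le_rfl
  have hpi : p⁻¹ ≤ θ⁻¹ := inv_anti₀ hθ (by linarith [h.two_theta_le])
  have hpm : (p ^ m)⁻¹ ≤ θ⁻¹ := inv_anti₀ hθ (by linarith [h.theta_le])
  have key (S : Finset (Fin m)) (hS : S.card = 3) :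
      |∑ v : Fin m → V, cliqueInd G v * ∑ w, (∏ i ∈ S, dev G p w (v i) / p) *
        ∏ a ∈ Finset.univ.filter (fun a => ∀ s ∈ S, s < a), (adjInd G w (v a) / p)| ≤
      2 * σ ^ 3 * θ⁻¹ ^ 7 * n * cliqueCount G m := by
    set T := Finset.univ.filter (fun a => ∀ s ∈ S, s < a) with hT
    have hTm : T.card ≤ m := (Finset.card_le_univ T).trans (by simp)
    have hTS (a : Fin m) (ha : a ∈ T) : a ∉ S := fun haS =>
      lt_irrefl a ((Finset.mem_filter.mp ha).2 a haS)
    have hm3 : 3 ≤ m := by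
      rw [← hS]; exact (Finset.card_le_univ S).trans (by simp)
    -- A power of p is inserted so that the factor not involving `S` lies in [0,1]; the price is
    -- p⁻³·p⁻ᵐ, at most θ⁻⁴.
    have e (v : Fin m → V) (w : V) : (∏ i ∈ S, dev G p w (v i) / p) *
        ∏ a ∈ T, (adjInd G w (v a) / p) = (p⁻¹ ^ 3 * (p ^ m)⁻¹) *
        ((p ^ (m - T.card) * ∏ a ∈ T, adjInd G w (v a)) * ∏ i ∈ S, dev G p w (v i)) := by
      rw [Finset.prod_div_distrib, Finset.prod_div_distrib, Finset.prod_const, Finset.prod_const, hS]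
      have : p ^ m = p ^ (m - T.card) * p ^ T.card := by rw [← pow_add]; congr 1; omega
      rw [this]
      field_simp
    have e2 : ∑ v : Fin m → V, cliqueInd G v * ∑ w, (∏ i ∈ S, dev G p w (v i) / p) *
        ∏ a ∈ T, (adjInd G w (v a) / p) = (p⁻¹ ^ 3 * (p ^ m)⁻¹) *
        ∑ v : Fin m → V, cliqueInd G v * ∑ w,
          (p ^ (m - T.card) * ∏ a ∈ T, adjInd G w (v a)) * ∏ i ∈ S, dev G p w (v i) := by
      simp_rw [e, ← Finset.mul_sum]
      rw [Finset.mul_sum]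
      exact Finset.sum_congr rfl fun v _ => by ring
    have hsplit := h.small.abs_sum_split_le S (by rw [hS]; decide) (by rw [hS])
      (κ := fun v => cliqueInd G v)
      (fun v => by
        rw [abs_of_nonneg (cliqueInd_nonneg G v)]
        exact cliqueInd_le_comp G v Subtype.val_injective)
      (b := fun w v => p ^ (m - T.card) * ∏ a ∈ T, adjInd G w (v a))
      (fun w v => by
        have h1 : 0 ≤ ∏ a ∈ T, adjInd G w (v a) :=
          Finset.prod_nonneg fun _ _ => adjInd_nonneg G _ _
        have h2 : ∏ a ∈ T, adjInd G w (v a) ≤ 1 :=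
          Finset.prod_le_one (fun _ _ => adjInd_nonneg G _ _) fun _ _ => adjInd_le_one G _ _
        rw [abs_of_nonneg (mul_nonneg (pow_nonneg hp.le _) h1)]
        exact mul_le_one₀ (pow_le_one₀ hp.le h.le_one) h1 h2)
      (fun w v v' hv => by
        congr 1
        exact Finset.prod_congr rfl fun a ha => by rw [hv a (hTS a ha)])
    rw [hS] at hsplit
    have hpow := h.pow_mul_cliqueCount_le (s := m - 3) 3 (by omega)
    rw [Nat.sub_add_cancel hm3] at hpow
    rw [e2, abs_mul, abs_of_nonneg (by positivity)]
    calc p⁻¹ ^ 3 * (p ^ m)⁻¹ * _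
        ≤ (θ⁻¹ ^ 3 * θ⁻¹) * (cliqueCount G (m - 3) * (2 * σ ^ 3 * n ^ (3 + 1))) := by
          refine mul_le_mul ?_ hsplit (abs_nonneg _) (by positivity)
          gcongr
      _ = θ⁻¹ ^ 4 * 2 * σ ^ 3 * n * (n ^ 3 * cliqueCount G (m - 3)) := by ring
      _ ≤ θ⁻¹ ^ 4 * 2 * σ ^ 3 * n * (θ⁻¹ ^ 3 * cliqueCount G m) :=
          mul_le_mul_of_nonneg_left hpow (by positivity)
      _ = _ := by ring
  have e : ∑ v : Fin m → V, cliqueInd G v * cubicRem G p v =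
      ∑ S ∈ powersetCard 3 (Finset.univ : Finset (Fin m)), ∑ v : Fin m → V, cliqueInd G v *
        ∑ w, (∏ i ∈ S, dev G p w (v i) / p) *
        ∏ a ∈ Finset.univ.filter (fun a => ∀ s ∈ S, s < a), (adjInd G w (v a) / p) := by
    rw [Finset.sum_comm]
    simp_rw [cubicRem, Finset.mul_sum (s := powersetCard 3 (Finset.univ : Finset (Fin m)))]
  rw [e]
  refine (Finset.abs_sum_le_sum_abs _ _).trans ?_
  refine (Finset.sum_le_sum fun S hS => key S (Finset.mem_powersetCard.mp hS).2).trans ?_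
  rw [Finset.sum_const, nsmul_eq_mul, Finset.card_powersetCard, Finset.card_univ, Fintype.card_fin]
  have hch : ((m.choose 3 : ℕ) : ℝ) ≤ (m : ℝ) ^ 3 := by exact_mod_cast Nat.choose_le_pow m 3
  calc ((m.choose 3 : ℕ) : ℝ) * (2 * σ ^ 3 * θ⁻¹ ^ 7 * n * cliqueCount G m)
      ≤ (m : ℝ) ^ 3 * (2 * σ ^ 3 * θ⁻¹ ^ 7 * n * cliqueCount G m) := by gcongr
    _ = _ := by ring

/-- The weight is itself of order σ² in mean square. Multiplied by the relative error σ of peeling,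
it yields the total error of order σ³ that the argument can afford. -/
theorem Quasirandom.kernelNorm_le (h : Quasirandom G p σ θ m) :
    kernelNorm (fun x y => adjInd G x y * pairWeight G p m x y) ≤
      4 * σ ^ 2 * θ⁻¹ ^ 2 * (Fintype.card V : ℝ) ^ 2 := by
  set n : ℝ := (Fintype.card V : ℝ) with hn
  have hn0 : 0 < n := h.small.card_pos
  have hθ := h.theta_pos
  have hσ := h.small.pos
  have hp : 0 < p := by linarith [h.two_theta_le]
  have hpi : p⁻¹ ≤ θ⁻¹ := inv_anti₀ hθ (by linarith [h.two_theta_le])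
  have hi : 1 ≤ θ⁻¹ := (one_le_inv₀ hθ).mpr h.theta_le_one
  have hm : (2 : ℝ) ≤ m := by exact_mod_cast h.two_le
  refine Real.sqrt_le_iff.mpr ⟨by positivity, ?_⟩
  have hpt (x y : V) : (adjInd G x y * pairWeight G p m x y) ^ 2 ≤
      8 * σ ^ 4 * θ⁻¹ ^ 4 * n ^ 2 + 2 * θ⁻¹ ^ 4 * codev (dev G p) x y ^ 2 := by
    have h1 : (adjInd G x y * pairWeight G p m x y) ^ 2 ≤ pairWeight G p m x y ^ 2 := by
      rw [mul_pow]
      exact mul_le_of_le_one_left (sq_nonneg _)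
        (pow_le_one₀ (adjInd_nonneg G x y) (adjInd_le_one G x y))
    set a := 2 * (∑ w, dev G p x w) / (p * (m - 1)) with ha
    set b := codev (dev G p) x y / p ^ 2 with hb
    have h2 : pairWeight G p m x y ^ 2 ≤ 2 * a ^ 2 + 2 * b ^ 2 := by
      rw [pairWeight, ← ha, ← hb]
      nlinarith [sq_nonneg (a - b)]
    have h3 : |a| ≤ 2 * σ ^ 2 * θ⁻¹ * n := by
      rw [ha, abs_div, abs_mul, abs_of_pos (show (0 : ℝ) < 2 by norm_num),
        abs_of_pos (show 0 < p * ((m : ℝ) - 1) by apply mul_pos hp; linarith), div_eq_mul_inv,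
        mul_inv]
      have h4 : ((m : ℝ) - 1)⁻¹ ≤ 1 := inv_le_one_of_one_le₀ (by linarith)
      have h5 : 0 ≤ ((m : ℝ) - 1)⁻¹ := inv_nonneg.mpr (by linarith)
      calc 2 * |∑ w, dev G p x w| * (p⁻¹ * ((m : ℝ) - 1)⁻¹) ≤ 2 * (σ ^ 2 * n) * (θ⁻¹ * 1) := by
            gcongr
            exact h.row_le x
        _ = _ := by ring
    have h6 : a ^ 2 ≤ 4 * σ ^ 4 * θ⁻¹ ^ 4 * n ^ 2 := by
      rw [← sq_abs]
      calc |a| ^ 2 ≤ (2 * σ ^ 2 * θ⁻¹ * n) ^ 2 := by gcongr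
        _ = 4 * σ ^ 4 * θ⁻¹ ^ 2 * n ^ 2 := by ring
        _ ≤ 4 * σ ^ 4 * θ⁻¹ ^ 4 * n ^ 2 := by gcongr; norm_num
    have h7 : b ^ 2 ≤ θ⁻¹ ^ 4 * codev (dev G p) x y ^ 2 := by
      have : b ^ 2 = p⁻¹ ^ 4 * codev (dev G p) x y ^ 2 := by rw [hb]; field_simp
      rw [this]
      gcongr
    linarith
  refine (Finset.sum_le_sum fun x _ => Finset.sum_le_sum fun y _ => hpt x y).trans ?_
  have hc := h.small.sum_sq_codev_le
  simp only [Finset.sum_add_distrib, ← Finset.mul_sum, Finset.sum_const, Finset.card_univ,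
    nsmul_eq_mul, ← hn] at hc ⊢
  have h8 := mul_le_mul_of_nonneg_left hc (show 0 ≤ 2 * θ⁻¹ ^ 4 by positivity)
  have h9 : (4 * σ ^ 2 * θ⁻¹ ^ 2 * n ^ 2) ^ 2 = 16 * σ ^ 4 * θ⁻¹ ^ 4 * n ^ 4 := by ring
  rw [h9]
  linarith

/-- If every clique with `m` vertices has at most `C * n` common neighbours, then the total weight
of the edges is bounded accordingly. -/
theorem Quasirandom.sum_pairWeight_le (h : Quasirandom G p σ θ m) {C : ℝ}
    (hC : ∀ v : Fin m → V, cliqueInd G v ≠ 0 →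
      ∑ w, ∏ i, adjInd G w (v i) ≤ C * Fintype.card V) :
    ∑ x, ∑ y, adjInd G x y * pairWeight G p m x y ≤ p * (Fintype.card V : ℝ) ^ 3 *
      (2 / (m * (m - 1)) * (C / p ^ m - 1) + 22 * m ^ 3 * σ ^ 3 * θ⁻¹ ^ 8) := by
  obtain ⟨t, rfl⟩ : ∃ t, m = t + 2 := ⟨m - 2, by have := h.two_le; omega⟩
  set n : ℝ := (Fintype.card V : ℝ) with hn
  have hn0 : 0 < n := h.small.card_pos
  have hθ := h.theta_pos
  have hσ := h.small.pos
  have hp : 0 < p := by linarith [h.two_theta_le]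
  have hi : 1 ≤ θ⁻¹ := (one_le_inv₀ hθ).mpr h.theta_le_one
  have hX := h.cliqueCount_pos le_rfl
  set M : ℝ := ((t + 2 : ℕ) : ℝ) with hM
  have hM2 : 2 ≤ M := by rw [hM]; exact_mod_cast h.two_le
  set φ : V → V → ℝ := fun x y => adjInd G x y * pairWeight G p (t + 2) x y with hφ
  set X := cliqueCount G (t + 2) with hXdef
  set Y := weightedExt G φ t with hY
  have h1 : ∑ v : Fin (t + 2) → V, cliqueInd G v * ∑ w, ∏ i, adjInd G w (v i) ≤ C * n * X := by
    rw [hXdef, cliqueCount, Finset.mul_sum]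
    refine Finset.sum_le_sum fun v _ => ?_
    by_cases hv : cliqueInd G v = 0
    · simp [hv]
    · rw [mul_comm]
      exact mul_le_mul_of_nonneg_right (hC v hv) (cliqueInd_nonneg G v)
  set R := ∑ v : Fin (t + 2) → V, cliqueInd G v * cubicRem G p v with hR
  have h2 : ∑ v : Fin (t + 2) → V, cliqueInd G v * ∑ w, ∏ i, adjInd G w (v i) =
      p ^ (t + 2) * (n * X + M * (M - 1) / 2 * Y + R) := by
    have e1 : ∑ v : Fin (t + 2) → V, cliqueInd G v *
        ∑ i, ∑ j ∈ Finset.univ.erase i, pairWeight G p (t + 2) (v i) (v j) / 2 =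
        M * (M - 1) / 2 * Y := by
      have e2 (i : Fin (t + 2)) (j) (hj : j ∈ Finset.univ.erase i) :
          ∑ v : Fin (t + 2) → V, cliqueInd G v * (pairWeight G p (t + 2) (v i) (v j) / 2) = Y / 2 := by
        rw [hY, ← sum_cliqueInd_mul_pair, Finset.sum_div,
          sum_cliqueInd_mul_eq_of_ne (fun x y => pairWeight G p (t + 2) x y / 2)
          (Finset.ne_of_mem_erase hj).symm]
        exact Finset.sum_congr rfl fun v _ => by ring
      simp_rw [Finset.mul_sum]
      rw [Finset.sum_comm]
      have e3 (i : Fin (t + 2)) : ∑ v : Fin (t + 2) → V, ∑ j ∈ Finset.univ.erase i,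
          cliqueInd G v * (pairWeight G p (t + 2) (v i) (v j) / 2) = (M - 1) * (Y / 2) := by
        rw [Finset.sum_comm, Finset.sum_congr rfl (e2 i), Finset.sum_const,
          Finset.card_erase_of_mem (Finset.mem_univ i), Finset.card_univ, Fintype.card_fin,
          nsmul_eq_mul, Nat.cast_sub (by omega), Nat.cast_one]
      rw [Finset.sum_congr rfl fun i _ => e3 i, Finset.sum_const, Finset.card_univ,
        Fintype.card_fin, nsmul_eq_mul]
      ring
    rw [← e1, hR, hXdef, cliqueCount, Finset.mul_sum, ← Finset.sum_add_distrib,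
      ← Finset.sum_add_distrib, Finset.mul_sum]
    refine Finset.sum_congr rfl fun v _ => ?_
    rw [sum_prod_adjInd_eq hp h.two_le]
    ring
  have h3 : |R| ≤ 2 * M ^ 3 * σ ^ 3 * θ⁻¹ ^ 7 * n * X := h.abs_sum_cubicRem_le
  have hMM : 0 < M * (M - 1) := by nlinarith
  have h4 : Y / X ≤ n * (2 / (M * (M - 1)) * (C / p ^ (t + 2) - 1) + 2 * M ^ 3 * σ ^ 3 * θ⁻¹ ^ 7) := by
    have h5 : n * X + M * (M - 1) / 2 * Y + R ≤ C / p ^ (t + 2) * n * X := by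
      rw [h2] at h1
      have e : C / p ^ (t + 2) * n * X = C * n * X / p ^ (t + 2) := by ring
      rw [e, le_div_iff₀ (by positivity)]
      linarith
    have h6 := (abs_le.mp h3).1
    rw [div_le_iff₀ hX]
    have h7 : M * (M - 1) / 2 * Y ≤
        ((C / p ^ (t + 2) - 1) + 2 * M ^ 3 * σ ^ 3 * θ⁻¹ ^ 7) * n * X := by linarith
    have h8 : Y ≤ 2 / (M * (M - 1)) *
        (((C / p ^ (t + 2) - 1) + 2 * M ^ 3 * σ ^ 3 * θ⁻¹ ^ 7) * n * X) := by
      rw [div_mul_eq_mul_div, le_div_iff₀ hMM]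
      linarith
    have h9 : 2 / (M * (M - 1)) ≤ 1 := by
      rw [div_le_one hMM]; nlinarith
    have h10 : 2 / (M * (M - 1)) * (2 * M ^ 3 * σ ^ 3 * θ⁻¹ ^ 7 * n * X) ≤
        2 * M ^ 3 * σ ^ 3 * θ⁻¹ ^ 7 * n * X :=
      mul_le_of_le_one_left (by positivity) h9
    linarith
  have hK := h.kernelNorm_le
  change kernelNorm φ ≤ _ at hK
  have hK0 := kernelNorm_nonneg φ
  have h5 := (abs_le.mp (h.abs_ratio_sub_zero_le φ (t := t) le_rfl)).1
  have h6 : (t : ℝ) * (4 * σ * M * θ⁻¹ ^ 6 * (kernelNorm φ / n)) ≤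
      16 * M ^ 3 * σ ^ 3 * θ⁻¹ ^ 8 * n := by
    have htM : (t : ℝ) ≤ M := by rw [hM]; push_cast; linarith
    have : kernelNorm φ / n ≤ 4 * σ ^ 2 * θ⁻¹ ^ 2 * n := by
      rw [div_le_iff₀ hn0]; linarith
    calc (t : ℝ) * (4 * σ * M * θ⁻¹ ^ 6 * (kernelNorm φ / n))
        ≤ M * (4 * σ * M * θ⁻¹ ^ 6 * (4 * σ ^ 2 * θ⁻¹ ^ 2 * n)) := by gcongr
      _ = 16 * M ^ 2 * σ ^ 3 * θ⁻¹ ^ 8 * n := by ring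
      _ ≤ 16 * M ^ 3 * σ ^ 3 * θ⁻¹ ^ 8 * n := by gcongr <;> linarith
  set Y0 := weightedExt G φ 0 with hY0
  have hY0e : Y0 = ∑ x, ∑ y, adjInd G x y * pairWeight G p (t + 2) x y := by
    simp [hY0, weightedExt, cliqueInd, Pairwise, hφ]
  set X2 := cliqueCount G 2 with hX2
  have hX2p : 0 < X2 := h.cliqueCount_pos h.two_le
  have hX2e : |X2 - p * n ^ 2| ≤ σ ^ 2 * n ^ 2 := by
    have e : X2 - p * n ^ 2 = ∑ u, ∑ w, dev G p u w := by
      rw [hX2, cliqueCount_add_two (G := G) 0]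
      simp [weightedExt, cliqueInd, Pairwise, dev, Finset.sum_sub_distrib, hn]
      ring
    rw [e]
    refine (Finset.abs_sum_le_sum_abs _ _).trans ((Finset.sum_le_sum fun u _ => h.row_le u).trans ?_)
    simp [hn]
    apply le_of_eq
    ring
  have hX2l : n ^ 2 ≤ θ⁻¹ ^ 2 * X2 := by
    simpa [cliqueCount_zero] using h.pow_mul_cliqueCount_le (s := 0) 2 (by omega)
  -- Replacing the edge count by p·n² costs σ⁴ in all; the spare σ pays for θ⁻⁴. The constant 22 is
  -- 2 + 16 + 4, from the cubic remainder, the peeling and this step.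
  have h7 : Y0 / (p * n ^ 2) - Y0 / X2 ≤ 4 * M ^ 3 * σ ^ 3 * θ⁻¹ ^ 8 * n := by
    have e : Y0 / (p * n ^ 2) - Y0 / X2 = Y0 * (X2 - p * n ^ 2) / (p * n ^ 2 * X2) := by
      field_simp
    rw [e]
    refine (le_abs_self _).trans ?_
    rw [abs_div, abs_mul, abs_of_pos (show 0 < p * n ^ 2 * X2 by positivity),
      div_le_iff₀ (by positivity)]
    have hb : |Y0| ≤ n * (4 * σ ^ 2 * θ⁻¹ ^ 2 * n ^ 2) := by
      have := abs_weightedExt_le (G := G) φ 0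
      rw [cliqueCount_zero, mul_one] at this
      exact this.trans (by gcongr)
    have hpi : θ ≤ p := by linarith [h.two_theta_le]
    have hs : σ ≤ θ ^ 4 := by linarith [h.sigma_le_theta]
    have hs1 : θ⁻¹ ^ 4 * σ ≤ 1 := by
      calc θ⁻¹ ^ 4 * σ ≤ θ⁻¹ ^ 4 * θ ^ 4 := by gcongr
        _ = 1 := by field_simp
    calc |Y0| * |X2 - p * n ^ 2| ≤ (n * (4 * σ ^ 2 * θ⁻¹ ^ 2 * n ^ 2)) * (σ ^ 2 * n ^ 2) := by gcongr
      _ = 4 * σ ^ 4 * θ⁻¹ ^ 2 * n ^ 3 * n ^ 2 := by ring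
      _ ≤ 4 * σ ^ 4 * θ⁻¹ ^ 2 * n ^ 3 * (θ⁻¹ ^ 2 * X2) := by gcongr
      _ = (θ⁻¹ ^ 4 * σ) * (4 * σ ^ 3 * n ^ 3 * X2) := by ring
      _ ≤ 1 * (4 * σ ^ 3 * n ^ 3 * X2) := by gcongr
      _ = 4 * 1 ^ 3 * σ ^ 3 * 1 ^ 7 * n * (1 * n ^ 2 * X2) := by ring
      _ ≤ 4 * M ^ 3 * σ ^ 3 * θ⁻¹ ^ 7 * n * ((θ⁻¹ * p) * n ^ 2 * X2) := by
        have : 1 ≤ θ⁻¹ * p := by rw [← div_eq_inv_mul, le_div_iff₀ hθ]; linarith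
        gcongr
        linarith
      _ = _ := by ring
  have h8 : Y0 / (p * n ^ 2) ≤
      n * (2 / (M * (M - 1)) * (C / p ^ (t + 2) - 1) + 22 * M ^ 3 * σ ^ 3 * θ⁻¹ ^ 8) := by
    have h9 : 2 * M ^ 3 * σ ^ 3 * θ⁻¹ ^ 7 * n ≤ 2 * M ^ 3 * σ ^ 3 * θ⁻¹ ^ 8 * n := by
      gcongr
      norm_num
    linarith
  rw [div_le_iff₀ (by positivity)] at h8
  rw [← hY0e]
  refine h8.trans (le_of_eq (by ring))

end EdgeBound

/-! ### Ramsey numbers, common neighbourhoods and complements -/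

section Graphs

theorem RamseyProp.symm {a b n : ℕ} (h : RamseyProp a b n) : RamseyProp b a n := by
  intro G
  rcases h Gᶜ with ⟨s, hs⟩ | ⟨s, hs⟩
  · exact Or.inr ⟨s, (SimpleGraph.isNClique_compl _).mp hs⟩
  · refine Or.inl ⟨s, ?_⟩
    rw [← SimpleGraph.isNClique_compl, compl_compl] at hs
    exact hs

theorem ramsey_comm (a b : ℕ) : ramsey a b = ramsey b a := by
  unfold ramsey
  congr 1
  ext n
  exact ⟨fun h => ⟨h.1, h.2.symm⟩, fun h => ⟨h.1, h.2.symm⟩⟩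

theorem exists_isNClique_of_ramsey_le {V : Type*} (G : SimpleGraph V) {a b : ℕ} (U : Finset V)
    (hU : ramsey a b ≤ U.card) :
    (∃ s ⊆ U, G.IsNClique a s) ∨ ∃ s ⊆ U, Gᶜ.IsNClique b s := by
  classical
  obtain ⟨f⟩ : Nonempty (Fin (ramsey a b) ↪ U) :=
    Function.Embedding.nonempty_of_card_le (by simpa using hU)
  let g : Fin (ramsey a b) ↪ V := f.trans (Function.Embedding.subtype _)
  have hg (s : Finset (Fin (ramsey a b))) : s.map g ⊆ U := by
    intro x hx
    obtain ⟨i, -, rfl⟩ := Finset.mem_map.mp hx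
    exact (f i).2
  have hmap (H : SimpleGraph V) {c : ℕ} {s : Finset (Fin (ramsey a b))}
      (hs : (H.comap g).IsNClique c s) : H.IsNClique c (s.map g) :=
    (hs.map (f := g)).mono (SimpleGraph.map_comap_le _ _)
  rcases (ramsey_spec a b).2 (G.comap g) with ⟨s, hs⟩ | ⟨s, hs⟩
  · exact Or.inl ⟨s.map g, hg s, hmap G hs⟩
  · refine Or.inr ⟨s.map g, hg s, hmap Gᶜ ?_⟩
    rw [← SimpleGraph.isNClique_compl] at hs
    have : (G.comap g)ᶜ = Gᶜ.comap g := by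
      ext i j
      simp [SimpleGraph.compl_adj]
    rwa [this] at hs

theorem exists_graph_of_lt_ramsey {a b n : ℕ} (hn : 0 < n) (h : n < ramsey a b) :
    ∃ G : SimpleGraph (Fin n), (∀ s, ¬ G.IsNClique a s) ∧ ∀ s, ¬ Gᶜ.IsNClique b s := by
  have h1 : ¬ RamseyProp a b n := fun h2 => Nat.notMem_of_lt_sInf h ⟨hn, h2⟩
  simp only [RamseyProp, not_forall, not_or, not_exists] at h1
  obtain ⟨G, hG⟩ := h1
  refine ⟨G, hG.1, fun s hs => hG.2 s ?_⟩
  exact (SimpleGraph.isNClique_compl _).mp hs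

variable {V : Type*} {G : SimpleGraph V} {p q : ℝ}

theorem dev_compl [DecidableEq V] (hpq : p + q = 1) (u w : V) :
    dev Gᶜ q u w = -dev G p u w - if u = w then 1 else 0 := by
  have : q = 1 - p := by linarith
  subst this
  by_cases huw : u = w
  · subst huw; simp [dev, adjInd]
  · by_cases h : G.Adj u w <;> simp [dev, adjInd, h, huw]

variable [Fintype V]

/-- Were the common neighbourhood of the m-clique too large, it would contain either an independent
set of size b or a clique of size k-m, and the latter together with the m-clique would form a clique
of size k. -/
theorem sum_prod_adjInd_lt_ramsey {k b m : ℕ} (hG : ∀ s, ¬ G.IsNClique k s)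
    (hG' : ∀ s, ¬ Gᶜ.IsNClique b s) (hm : m ≤ k) {v : Fin m → V} (hv : cliqueInd G v ≠ 0) :
    ∑ w, ∏ i, adjInd G w (v i) < ramsey (k - m) b := by
  classical
  set U : Finset V := Finset.univ.filter fun w => ∀ i, G.Adj w (v i) with hU
  have hcard : ∑ w, ∏ i, adjInd G w (v i) = U.card := by
    rw [hU, Finset.card_filter]
    push_cast
    refine Finset.sum_congr rfl fun w _ => ?_
    split_ifs with h
    · simp [adjInd, h]
    · push Not at h
      obtain ⟨i, hi⟩ := h
      exact Finset.prod_eq_zero (Finset.mem_univ i) (by simp [adjInd, hi])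
  rw [hcard]
  by_contra hlt
  have hle : ramsey (k - m) b ≤ U.card := by exact_mod_cast not_lt.mp hlt
  have hpw : Pairwise fun i j => G.Adj (v i) (v j) := by
    by_contra h
    exact hv (if_neg h)
  have hinj : Function.Injective v := by
    intro i j hij
    by_contra hne
    exact G.ne_of_adj (hpw hne) hij
  rcases exists_isNClique_of_ramsey_le G U hle with ⟨s, hsU, hs⟩ | ⟨s, -, hs⟩
  · refine hG (s ∪ Finset.univ.image v) ⟨?_, ?_⟩
    · intro x hx y hy hxy
      simp only [Finset.coe_union, Set.mem_union, Finset.mem_coe, Finset.mem_image,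
        Finset.mem_univ, true_and] at hx hy
      rcases hx with hx | ⟨i, rfl⟩ <;> rcases hy with hy | ⟨j, rfl⟩
      · exact hs.1 hx hy hxy
      · exact (Finset.mem_filter.mp (hsU hx)).2 j
      · exact ((Finset.mem_filter.mp (hsU hy)).2 i).symm
      · exact hpw fun h => hxy (by rw [h])
    · rw [Finset.card_union_of_disjoint, hs.2, Finset.card_image_of_injective _ hinj]
      · simp; omega
      · rw [Finset.disjoint_left]
        intro x hx hx'
        obtain ⟨i, -, rfl⟩ := Finset.mem_image.mp hx'
        exact G.irrefl ((Finset.mem_filter.mp (hsU hx)).2 i)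
  · exact hG' s hs

theorem sum_dev_compl (hpq : p + q = 1) (u : V) :
    ∑ w, dev Gᶜ q u w = -∑ w, dev G p u w - 1 := by
  classical
  simp [dev_compl hpq, Finset.sum_sub_distrib]

/-- The deviation kernel of the complement is -F minus the identity. The sign disappears in inner
products, so a graph and its complement agree up to a bounded correction. -/
theorem codev_compl [DecidableEq V] (hpq : p + q = 1) (u w : V) :
    codev (dev Gᶜ q) u w =
      codev (dev G p) u w + 2 * dev G p u w + if u = w then 1 else 0 := by
  have h (x : V) : dev Gᶜ q u x * dev Gᶜ q w x = dev G p u x * dev G p w x +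
      (if w = x then dev G p u x else 0) + (if u = x then dev G p w x else 0) +
      if u = x then (if w = x then 1 else 0) else 0 := by
    rw [dev_compl hpq, dev_compl hpq]
    split_ifs <;> ring
  rw [codev, Finset.sum_congr rfl fun x _ => h x]
  simp only [Finset.sum_add_distrib, Finset.sum_ite_eq, Finset.mem_univ, if_true, codev]
  rw [dev_comm G p w u]
  have : (if w = u then (1 : ℝ) else 0) = if u = w then 1 else 0 := by simp only [eq_comm]
  rw [this]
  ring

theorem codev_dev_eq (p : ℝ) (u v : V) :
    codev (dev G p) u v = ∑ w, adjInd G w u * adjInd G w v -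
      p * (∑ w, dev G p u w + ∑ w, dev G p v w) - p ^ 2 * Fintype.card V := by
  have h : p ^ 2 * (Fintype.card V : ℝ) = ∑ _w : V, p ^ 2 := by simp; ring
  rw [codev, h, ← Finset.sum_add_distrib, Finset.mul_sum, ← Finset.sum_sub_distrib,
    ← Finset.sum_sub_distrib]
  refine Finset.sum_congr rfl fun w _ => ?_
  rw [adjInd_comm G w u, adjInd_comm G w v, dev, dev]
  ring

end Graphs

/-! ### Ratios of binomial coefficients -/

section Binomials

/-- Ratio `binom(k + l - j, l) / binom(k + l, l)`. -/
noncomputable def chooseRatio (k l j : ℕ) : ℝ :=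
  ((k + l - j).choose l : ℝ) / ((k + l).choose l : ℝ)

theorem chooseRatio_zero (k l : ℕ) : chooseRatio k l 0 = 1 := by
  have : 0 < (k + l).choose l := Nat.choose_pos (by omega)
  rw [chooseRatio, Nat.sub_zero, div_self]
  positivity

theorem chooseRatio_succ {k l j : ℕ} (hj : j < k) :
    chooseRatio k l (j + 1) = chooseRatio k l j * (((k : ℝ) - j) / ((k : ℝ) + l - j)) := by
  obtain ⟨d, rfl⟩ : ∃ d, k = j + d + 1 := ⟨k - j - 1, by omega⟩
  have e1 : j + d + 1 + l - (j + 1) = d + l := by omega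
  have e2 : j + d + 1 + l - j = d + l + 1 := by omega
  rw [chooseRatio, chooseRatio, e1, e2]
  have h := Nat.choose_mul_succ_eq (d + l) l
  have e3 : d + l + 1 - l = d + 1 := by omega
  rw [e3] at h
  have h' : ((d + l).choose l : ℝ) * (d + l + 1) = (d + l + 1).choose l * (d + 1) := by
    exact_mod_cast h
  have e4 : (((j + d + 1 : ℕ) : ℝ) - j) / (((j + d + 1 : ℕ) : ℝ) + l - j) = (d + 1) / (d + l + 1) := by
    push_cast
    congr 1 <;> ring
  have h5 : (0 : ℝ) < d + l + 1 := by positivity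
  rw [e4, div_mul_div_comm, ← h']
  field_simp

/-- The factor (k-j)/(k+l-j) is at most k/(k+l)·(1 - j·l/(k(k+l))), and the deficits over j < m add
up in the exponent. -/
theorem chooseRatio_le {k l m : ℕ} (hl : 0 < l) (hm : m ≤ k) :
    chooseRatio k l m ≤ ((k : ℝ) / (k + l)) ^ m *
      Real.exp (-((m : ℝ) * (m - 1) / 2 * (l / (k * (k + l))))) := by
  induction m with
  | zero => simp [chooseRatio_zero]
  | succ m ih =>
    have hk : (0 : ℝ) < k := by exact_mod_cast (by omega : 0 < k)
    have hl' : (0 : ℝ) < l := by exact_mod_cast hl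
    have hmk : (m : ℝ) < k := by exact_mod_cast hm
    have hm0 : (0 : ℝ) ≤ m := by positivity
    rw [chooseRatio_succ (by omega)]
    have h1 : ((k : ℝ) - m) / (k + l - m) ≤ (k / (k + l)) * Real.exp (-(m * (l / (k * (k + l))))) := by
      have h2 : ((k : ℝ) - m) / (k + l - m) ≤ (k / (k + l)) * (1 - m * (l / (k * (k + l)))) := by
        have e : (k / (k + l)) * (1 - m * (l / (k * (k + l)))) =
            ((k : ℝ) * (k + l) - m * l) / (k + l) ^ 2 := by
          field_simp
        rw [e, div_le_div_iff₀ (by linarith) (by positivity)]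
        nlinarith [mul_nonneg (mul_nonneg hm0 hm0) hl'.le]
      refine h2.trans (mul_le_mul_of_nonneg_left ?_ (by positivity))
      have := Real.add_one_le_exp (-((m : ℝ) * (l / (k * (k + l)))))
      linarith
    refine (mul_le_mul (ih (by omega)) h1 (div_nonneg (by linarith) (by linarith))
      (by positivity)).trans (le_of_eq ?_)
    have e : Real.exp (-(((m + 1 : ℕ) : ℝ) * ((m + 1 : ℕ) - 1) / 2 * (l / (k * (k + l))))) =
        Real.exp (-((m : ℝ) * (m - 1) / 2 * (l / (k * (k + l))))) *
        Real.exp (-(m * (l / (k * (k + l))))) := by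
      rw [← Real.exp_add]
      congr 1
      push_cast
      ring
    rw [e, pow_succ]
    ring

end Binomials

/-! ### Combining a graph with its complement -/

section Contradiction

variable {V : Type*} [Fintype V] {G : SimpleGraph V} {p q β γ B σ θ : ℝ} {m : ℕ}

theorem sum_dev_eq (p : ℝ) (u : V) :
    ∑ w, dev G p u w = ∑ w, adjInd G u w - p * Fintype.card V := by
  rw [sum_adjInd p]; ring

/-- Upper bounds for degrees and codegrees, as provided by bounds for smaller Ramsey numbers. -/
structure DegreeBounds (G : SimpleGraph V) (p β : ℝ) : Prop where
  deg_le : ∀ u, ∑ w, adjInd G u w ≤ (1 + β) * p * Fintype.card V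
  codeg_le : ∀ u v, G.Adj u v →
    ∑ w, adjInd G w u * adjInd G w v ≤ (1 + 2 * β) * p ^ 2 * Fintype.card V

theorem DegreeBounds.sum_dev_le (h : DegreeBounds G p β) (u : V) :
    ∑ w, dev G p u w ≤ β * p * Fintype.card V := by
  rw [sum_dev_eq]
  linarith [h.deg_le u]

/-- An upper bound for degrees in the complement is a lower bound for degrees in G, up to the
missing loop. -/
theorem DegreeBounds.abs_sum_dev_le (h : DegreeBounds G p β) (h' : DegreeBounds Gᶜ q γ)
    (hpq : p + q = 1) (hp : 0 ≤ p) (hq : 0 ≤ q) (hB : |β| + |γ| ≤ B) (u : V) :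
    |∑ w, dev G p u w| ≤ B * Fintype.card V + 1 := by
  have hn : (0 : ℝ) ≤ Fintype.card V := by positivity
  have h1 := h.sum_dev_le u
  have h2 := h'.sum_dev_le u
  rw [sum_dev_compl hpq] at h2
  have h3 : β * p ≤ B := by
    have := le_abs_self β; have := abs_nonneg β; have := abs_nonneg γ
    nlinarith
  have h4 : γ * q ≤ B := by
    have := le_abs_self γ; have := abs_nonneg β; have := abs_nonneg γ
    nlinarith
  have h5 := mul_le_mul_of_nonneg_right h3 hn
  have h6 := mul_le_mul_of_nonneg_right h4 hn
  rw [abs_le]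
  constructor <;> linarith

theorem DegreeBounds.codev_le_of_adj (h : DegreeBounds G p β) (h' : DegreeBounds Gᶜ q γ)
    (hpq : p + q = 1) (hp : 0 ≤ p) (hq : 0 ≤ q) (hB : |β| + |γ| ≤ B) {u v : V} (huv : G.Adj u v) :
    codev (dev G p) u v ≤ 4 * B * Fintype.card V + 2 := by
  have hn : (0 : ℝ) ≤ Fintype.card V := by positivity
  have hp1 : p ≤ 1 := by linarith
  have h1 := h.codeg_le u v huv
  have h2 := (abs_le.mp (h.abs_sum_dev_le h' hpq hp hq hB u)).1
  have h3 := (abs_le.mp (h.abs_sum_dev_le h' hpq hp hq hB v)).1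
  have hβ : |β| ≤ B := by linarith [abs_nonneg γ]
  have hB0 : 0 ≤ B := (abs_nonneg β).trans hβ
  rw [codev_dev_eq]
  have h4 : p * (-(B * Fintype.card V + 1) + -(B * Fintype.card V + 1)) ≤
      p * (∑ w, dev G p u w + ∑ w, dev G p v w) := mul_le_mul_of_nonneg_left (by linarith) hp
  have h5 : p * (2 * (B * Fintype.card V + 1)) ≤ 1 * (2 * (B * Fintype.card V + 1)) :=
    mul_le_mul_of_nonneg_right hp1 (by positivity)
  have h6 : β * p ^ 2 ≤ B := by
    have hp2 : p ^ 2 ≤ 1 := pow_le_one₀ hp hp1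
    nlinarith [le_abs_self β, sq_nonneg p]
  have h7 := mul_le_mul_of_nonneg_right h6 hn
  linarith

/-- A non-adjacent pair is adjacent in the complement, and passing there changes the inner product
by at most 2. -/
theorem DegreeBounds.codev_le (h : DegreeBounds G p β) (h' : DegreeBounds Gᶜ q γ)
    (hpq : p + q = 1) (hp : 0 ≤ p) (hq : 0 ≤ q) (hB : |β| + |γ| ≤ B) {u v : V} (huv : u ≠ v) :
    codev (dev G p) u v ≤ 4 * B * Fintype.card V + 4 := by
  classical
  by_cases hadj : G.Adj u v
  · linarith [h.codev_le_of_adj h' hpq hp hq hB hadj]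
  · have hc : Gᶜ.Adj u v := (SimpleGraph.compl_adj _ _ _).mpr ⟨huv, hadj⟩
    have h1 := h'.codev_le_of_adj (B := B) (by rwa [compl_compl]) (by rwa [add_comm]) hq hp
      (by rwa [add_comm]) hc
    rw [codev_compl hpq, if_neg huv] at h1
    have h2 := (abs_le.mp (abs_dev_le G hp (by linarith : p ≤ 1) u v)).1
    linarith

theorem DegreeBounds.quasirandom (h : DegreeBounds G p β) (h' : DegreeBounds Gᶜ q γ)
    (hpq : p + q = 1) (hp : 0 ≤ p) (hq : 0 ≤ q) (hB : |β| + |γ| ≤ B)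
    (hBσ : 4 * B * Fintype.card V + 4 ≤ σ ^ 2 * Fintype.card V)
    (hσ : 0 < σ) (hn : 1 ≤ σ ^ 6 * Fintype.card V) (hθ : 0 < θ) (hθp : 2 * θ ≤ p ^ m)
    (hσθ : 2 * m * σ ≤ θ ^ 4) (hm : 2 ≤ m) : Quasirandom G p σ θ m where
  small :=
    { pos := hσ
      le_one := by
        have h1 : (2 : ℝ) ≤ m := by exact_mod_cast hm
        have h2 : p ^ m ≤ 1 := pow_le_one₀ hp (by linarith)
        have h3 : θ ^ 4 ≤ 1 := pow_le_one₀ hθ.le (by linarith)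
        nlinarith
      abs_le := abs_dev_le G hp (by linarith)
      codev_le := fun u w huw => (h.codev_le h' hpq hp hq hB huw).trans hBσ
      card_ge := hn }
  nonneg := hp
  le_one := by linarith
  theta_pos := hθ
  theta_le := hθp
  sigma_le := hσθ
  two_le := hm
  row_le := fun u => by
    have hB0 : 0 ≤ B := by linarith [abs_nonneg β, abs_nonneg γ]
    have hn : (0 : ℝ) ≤ Fintype.card V := by positivity
    have := h.abs_sum_dev_le h' hpq hp hq hB u
    nlinarith [mul_nonneg hB0 hn]

theorem sum_pairWeight_eq (hp : p ≠ 0) :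
    p ^ 2 * ∑ x, ∑ y, adjInd G x y * pairWeight G p m x y =
      2 * p / (m - 1) * (p * Fintype.card V * ∑ x, ∑ w, dev G p x w +
        ∑ x, (∑ w, dev G p x w) ^ 2) + ∑ x, ∑ y, adjInd G x y * codev (dev G p) x y := by
  rw [Finset.mul_sum, Finset.mul_sum, ← Finset.sum_add_distrib, Finset.mul_sum,
    ← Finset.sum_add_distrib]
  refine Finset.sum_congr rfl fun x _ => ?_
  have h : ∑ y, adjInd G x y * pairWeight G p m x y =
      2 * (∑ w, dev G p x w) / (p * (m - 1)) * ∑ y, adjInd G x y +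
      (∑ y, adjInd G x y * codev (dev G p) x y) / p ^ 2 := by
    rw [Finset.mul_sum, Finset.sum_div, ← Finset.sum_add_distrib]
    refine Finset.sum_congr rfl fun y _ => ?_
    rw [pairWeight]
    ring
  rw [h, sum_adjInd p]
  rw [mul_add, mul_div_cancel₀ _ (pow_ne_zero 2 hp)]
  congr 1
  have : p ^ 2 * (2 * (∑ w, dev G p x w) / (p * (m - 1))) = 2 * p / (m - 1) * ∑ w, dev G p x w := by
    rw [mul_comm p ((m : ℝ) - 1), ← div_div]
    field_simp
  rw [← mul_assoc, this]
  ring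

/-- The edges of G and of its complement partition the off-diagonal pairs, so the two sums make up
the sum of all inner products of rows of F, which is nonnegative. The loss is 2 per pair and at most
n per diagonal entry. -/
theorem sum_codev_add_compl_ge (hpq : p + q = 1) (hp : 0 ≤ p) (hq : 0 ≤ q) :
    -(3 * (Fintype.card V : ℝ) ^ 2) ≤ ∑ x, ∑ y, adjInd G x y * codev (dev G p) x y +
      ∑ x, ∑ y, adjInd Gᶜ x y * codev (dev Gᶜ q) x y := by
  classical
  have hp1 : p ≤ 1 := by linarith
  have h0 := sum_codev_pow_nonneg (dev G p) 1
  simp only [pow_one] at h0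
  have hpt (x y : V) : codev (dev G p) x y - (if x = y then (Fintype.card V : ℝ) else 0) - 2 ≤
      adjInd G x y * codev (dev G p) x y + adjInd Gᶜ x y * codev (dev Gᶜ q) x y := by
    by_cases hxy : x = y
    · subst hxy
      have h1 := (le_abs_self _).trans (abs_codev_le (abs_dev_le G hp hp1) x x)
      simp only [adjInd_self, if_true, zero_mul, add_zero]
      linarith
    · have h2 := (abs_le.mp (abs_dev_le G hp hp1 x y)).1
      rw [codev_compl hpq, if_neg hxy, if_neg hxy]
      by_cases h : G.Adj x y
      · simp only [adjInd, h, SimpleGraph.compl_adj, not_true, and_false, if_true, if_false]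
        linarith
      · simp only [adjInd, h, SimpleGraph.compl_adj, hxy, ne_eq, not_false_eq_true, and_self,
          if_true, if_false]
        linarith
  have h1 := Finset.sum_le_sum fun x (_ : x ∈ Finset.univ) =>
    Finset.sum_le_sum fun y (_ : y ∈ Finset.univ) => hpt x y
  simp only [Finset.sum_add_distrib, Finset.sum_sub_distrib, Finset.sum_ite_eq, Finset.mem_univ,
    if_true, Finset.sum_const, Finset.card_univ, nsmul_eq_mul] at h1
  nlinarith

/-- Multiplying by p²(m-1) gives the quadratic sums of a graph and its complement the same
coefficient, so that they can be added. The sum of squared degree deviations enters with a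
favourable sign and is dropped. -/
theorem Quasirandom.sum_codev_edges_le (h : Quasirandom G p σ θ m) {C E : ℝ}
    (hC : ∀ v : Fin m → V, cliqueInd G v ≠ 0 →
      ∑ w, ∏ i, adjInd G w (v i) ≤ C * Fintype.card V)
    (hE : C / p ^ m - 1 ≤ m * E) :
    2 * p * (p * Fintype.card V * ∑ x, ∑ w, dev G p x w) +
      (m - 1) * ∑ x, ∑ y, adjInd G x y * codev (dev G p) x y ≤
    p ^ 3 * (Fintype.card V : ℝ) ^ 3 *
      (2 * E + (m - 1) * (22 * m ^ 3 * σ ^ 3 * θ⁻¹ ^ 8)) := by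
  have hp : 0 < p := by linarith [h.two_theta_le, h.theta_pos]
  have b := mul_le_mul_of_nonneg_left (h.sum_pairWeight_le hC) (sq_nonneg p)
  rw [sum_pairWeight_eq hp.ne'] at b
  have hn0 : (0 : ℝ) < Fintype.card V := h.small.card_pos
  set n : ℝ := (Fintype.card V : ℝ) with hn
  have hm : (2 : ℝ) ≤ m := by exact_mod_cast h.two_le
  have hm1 : 0 < (m : ℝ) - 1 := by linarith
  set T := ∑ x, ∑ w, dev G p x w
  set Q := ∑ x, (∑ w, dev G p x w) ^ 2 with hQ
  have hQ0 : 0 ≤ Q := Finset.sum_nonneg fun _ _ => sq_nonneg _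
  set P := ∑ x, ∑ y, adjInd G x y * codev (dev G p) x y
  set e := 22 * (m : ℝ) ^ 3 * σ ^ 3 * θ⁻¹ ^ 8 with he
  have h1 : 2 / ((m : ℝ) * (m - 1)) * (C / p ^ m - 1) ≤ 2 * E / (m - 1) := by
    calc 2 / ((m : ℝ) * (m - 1)) * (C / p ^ m - 1) ≤ 2 / ((m : ℝ) * (m - 1)) * (m * E) := by
          gcongr
      _ = _ := by field_simp
  have h2 : 2 * p / (m - 1) * (p * n * T + Q) + P ≤ p ^ 3 * n ^ 3 * (2 * E / (m - 1) + e) := by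
    refine b.trans ?_
    calc p ^ 2 * (p * n ^ 3 * (2 / ((m : ℝ) * (m - 1)) * (C / p ^ m - 1) + e))
        = p ^ 3 * n ^ 3 * (2 / ((m : ℝ) * (m - 1)) * (C / p ^ m - 1) + e) := by ring
      _ ≤ _ := by gcongr
  have h3 := mul_le_mul_of_nonneg_left h2 hm1.le
  have h4 : ((m : ℝ) - 1) * (2 * p / (m - 1) * (p * n * T + Q) + P) =
      2 * p * (p * n * T + Q) + (m - 1) * P := by field_simp
  have h5 : ((m : ℝ) - 1) * (p ^ 3 * n ^ 3 * (2 * E / (m - 1) + e)) =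
      p ^ 3 * n ^ 3 * (2 * E + (m - 1) * e) := by field_simp
  rw [h4, h5] at h3
  have := mul_nonneg hp.le hQ0
  linarith

/-- In the sum of the two inequalities T has coefficient 2(p²-q²)n, nonnegative because q ≤ p. So a
lower bound on T suffices, and that comes from the degrees of the complement. -/
theorem linear_bound_of_scaled {n m p q E E' γ T P P' e : ℝ} (hn : 0 < n) (hm : 2 ≤ m)
    (hq : 0 < q) (hpq : p + q = 1) (hqp : q ≤ p) (he : 0 ≤ e)
    (c : 2 * p * (p * n * T) + (m - 1) * P ≤ p ^ 3 * n ^ 3 * (2 * E + (m - 1) * e))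
    (c' : 2 * q * (q * n * (-T - n)) + (m - 1) * P' ≤ q ^ 3 * n ^ 3 * (2 * E' + (m - 1) * e))
    (hT : -(γ * q * n ^ 2) - n ≤ T) (hS : -(3 * n ^ 2) ≤ P + P') :
    0 ≤ p ^ 3 * E + q ^ 3 * E' + (p ^ 2 - q ^ 2) * q * γ + m * e + 4 * m / n := by
  have hp : 0 < p := by linarith
  have hp1 : p ≤ 1 := by linarith
  have hpq2 : 0 ≤ p ^ 2 - q ^ 2 := by nlinarith
  have hT2 := mul_le_mul_of_nonneg_left hT (mul_nonneg hpq2 hn.le)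
  have hS2 := mul_le_mul_of_nonneg_left hS (show 0 ≤ m - 1 by linarith)
  have hp2 : p ^ 2 ≤ 1 := pow_le_one₀ hp.le hp1
  have hpe : p ^ 3 + q ^ 3 ≤ 1 := by
    have : q = 1 - p := by linarith
    subst this
    nlinarith
  have hme : 0 ≤ (m - 1) * e := mul_nonneg (by linarith) he
  have f : 0 ≤ 2 * n ^ 3 * (p ^ 3 * E + q ^ 3 * E' + (p ^ 2 - q ^ 2) * q * γ) +
      n ^ 3 * ((m - 1) * e) + (3 * (m - 1) + 2) * n ^ 2 := by
    have g1 : (p ^ 3 + q ^ 3) * (n ^ 3 * ((m - 1) * e)) ≤ 1 * (n ^ 3 * ((m - 1) * e)) :=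
      mul_le_mul_of_nonneg_right hpe (by positivity)
    have g2 : p ^ 2 * n ^ 2 ≤ 1 * n ^ 2 := mul_le_mul_of_nonneg_right hp2 (by positivity)
    linarith
  have hn3 : 0 < 2 * n ^ 3 := by positivity
  have f2 : 2 * n ^ 3 * (4 * m / n) = 8 * m * n ^ 2 := by field_simp; ring
  have f4 : n ^ 3 * ((m - 1) * e) ≤ 2 * n ^ 3 * (m * e) := by
    have : (m - 1) * e ≤ 2 * (m * e) := by nlinarith
    have := mul_le_mul_of_nonneg_left this (pow_nonneg hn.le 3)
    linarith
  have f5 : (3 * (m - 1) + 2) * n ^ 2 ≤ 8 * m * n ^ 2 :=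
    mul_le_mul_of_nonneg_right (by linarith) (by positivity)
  refine le_of_mul_le_mul_left ?_ hn3
  rw [mul_zero, mul_add, mul_add, f2]
  linarith

/-- Consequence of the two edge bounds for a graph and its complement. -/
theorem Quasirandom.linear_bound (h : Quasirandom G p σ θ m) (h' : Quasirandom Gᶜ q σ θ m)
    (hd' : DegreeBounds Gᶜ q γ) (hpq : p + q = 1) (hqp : q ≤ p) {C C' E E' : ℝ}
    (hC : ∀ v : Fin m → V, cliqueInd G v ≠ 0 →
      ∑ w, ∏ i, adjInd G w (v i) ≤ C * Fintype.card V)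
    (hC' : ∀ v : Fin m → V, cliqueInd Gᶜ v ≠ 0 →
      ∑ w, ∏ i, adjInd Gᶜ w (v i) ≤ C' * Fintype.card V)
    (hE : C / p ^ m - 1 ≤ m * E) (hE' : C' / q ^ m - 1 ≤ m * E') :
    0 ≤ p ^ 3 * E + q ^ 3 * E' + (p ^ 2 - q ^ 2) * q * γ +
      m * (22 * m ^ 3 * σ ^ 3 * θ⁻¹ ^ 8) + 4 * m / Fintype.card V := by
  have hp : 0 < p := by linarith [h.two_theta_le, h.theta_pos]
  have hq : 0 < q := by linarith [h'.two_theta_le, h'.theta_pos]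
  have hθ := h.theta_pos
  have hσ := h.small.pos
  have hT' : ∑ x, ∑ w, dev Gᶜ q x w = -(∑ x, ∑ w, dev G p x w) - Fintype.card V := by
    simp [sum_dev_compl hpq, Finset.sum_sub_distrib]
  have c' := h'.sum_codev_edges_le hC' hE'
  rw [hT'] at c'
  have hTl : ∑ x, ∑ w, dev Gᶜ q x w ≤ ∑ _x : V, γ * q * Fintype.card V :=
    Finset.sum_le_sum fun x _ => hd'.sum_dev_le x
  rw [hT'] at hTl
  simp only [Finset.sum_const, Finset.card_univ, nsmul_eq_mul] at hTl
  exact linear_bound_of_scaled h.small.card_pos (by exact_mod_cast h.two_le) hq hpq hqp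
    (by positivity) (h.sum_codev_edges_le hC hE) c' (by linarith)
    (sum_codev_add_compl_ge hpq hp.le hq.le)

end Contradiction

/-! ### From bounds on smaller Ramsey numbers to the contradiction -/

section Bridge

theorem chooseRatio_one {k : ℕ} (l : ℕ) (hk : 0 < k) : chooseRatio k l 1 = (k : ℝ) / (k + l) := by
  rw [← zero_add 1, chooseRatio_succ hk, chooseRatio_zero]
  simp

theorem chooseRatio_le_pow {k l m : ℕ} (hl : 0 < l) (hm : m ≤ k) :
    chooseRatio k l m ≤ ((k : ℝ) / (k + l)) ^ m := by
  refine (chooseRatio_le hl hm).trans (mul_le_of_le_one_right (by positivity) ?_)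
  rw [Real.exp_le_one_iff, neg_nonpos]
  rcases m with _ | m
  · simp
  · push_cast
    rw [add_sub_cancel_right]
    positivity

theorem degreeBounds_of_ramsey_le {V : Type*} [Fintype V] {G : SimpleGraph V} {k l : ℕ} {β : ℝ}
    (hG : ∀ s, ¬ G.IsNClique (k + 1) s) (hG' : ∀ s, ¬ Gᶜ.IsNClique (l + 1) s) (hl : 0 < l)
    (hk : 2 ≤ k) (hβ : 0 ≤ 1 + 2 * β)
    (h1 : (ramsey (k + 1 - 1) (l + 1) : ℝ) ≤ (1 + (1 : ℕ) * β) * (chooseRatio k l 1 * Fintype.card V))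
    (h2 : (ramsey (k + 1 - 2) (l + 1) : ℝ) ≤ (1 + (2 : ℕ) * β) * (chooseRatio k l 2 * Fintype.card V)) :
    DegreeBounds G ((k : ℝ) / (k + l)) β where
  deg_le u := by
    have hv : cliqueInd G (fun _ : Fin 1 => u) ≠ 0 := by simp [cliqueInd, Subsingleton.pairwise]
    have := (sum_prod_adjInd_lt_ramsey hG hG' (by omega) hv).le.trans h1
    rw [chooseRatio_one l (by omega)] at this
    simp only [Finset.univ_unique, Finset.prod_singleton, adjInd_comm G _ u] at this
    push_cast at this
    linarith
  codeg_le u v huv := by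
    have hv : cliqueInd G ![u, v] ≠ 0 := by
      have : Pairwise fun i j => G.Adj (![u, v] i) (![u, v] j) := by
        intro i j hij
        fin_cases i <;> fin_cases j <;> simp_all [G.adj_comm]
      simp [cliqueInd, this]
    have := (sum_prod_adjInd_lt_ramsey hG hG' (by omega) hv).le.trans h2
    simp only [Fin.prod_univ_two, Matrix.cons_val_zero, Matrix.cons_val_one] at this
    refine this.trans ?_
    push_cast
    rw [mul_assoc (1 + 2 * β)]
    refine mul_le_mul_of_nonneg_left ?_ hβ
    exact mul_le_mul_of_nonneg_right (chooseRatio_le_pow hl hk) (by positivity)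

theorem exp_neg_le {A : ℝ} (h0 : 0 ≤ A) (h1 : A ≤ 1) : Real.exp (-A) ≤ 1 - A + A ^ 2 := by
  have := Real.abs_exp_sub_one_sub_id_le (x := -A) (by rw [abs_neg, abs_of_nonneg h0]; exact h1)
  have := (abs_le.mp this).2
  rw [neg_sq] at this
  linarith

/-- With A the exponent in `chooseRatio_le`, expand (1+mβ)(1-A+A²) - 1: the first-order part is mβ -
A, and A₀ ≥ A serves only in the second-order errors. -/
theorem chooseRatio_div_le {k l m : ℕ} {β B A₀ : ℝ} (hl : 0 < l) (hm : m ≤ k) (hm1 : 1 ≤ m)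
    (hB : |β| ≤ B) (hmB : m * B ≤ 1)
    (hA₀ : (m : ℝ) * (m - 1) / 2 * (l / (k * (k + l))) ≤ A₀) (hA1 : A₀ ≤ 1) :
    (1 + m * β) * chooseRatio k l m / ((k : ℝ) / (k + l)) ^ m - 1 ≤
      m * (β - (m - 1) / 2 * (l / (k * (k + l))) + (2 * A₀ ^ 2 + B * A₀)) := by
  have hk : (0 : ℝ) < k := by exact_mod_cast (by omega : 0 < k)
  have hl' : (0 : ℝ) < l := by exact_mod_cast hl
  have hm' : (1 : ℝ) ≤ m := by exact_mod_cast hm1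
  set A := (m : ℝ) * (m - 1) / 2 * (l / (k * (k + l))) with hA
  have hA0 : 0 ≤ A := mul_nonneg (by nlinarith) (by positivity)
  have hp : 0 < ((k : ℝ) / (k + l)) ^ m := by positivity
  have hmβ := abs_le.mp hB
  have h1 : 0 ≤ 1 + m * β := by nlinarith
  have h2 : 1 + m * β ≤ 2 := by nlinarith
  have h3 : chooseRatio k l m / ((k : ℝ) / (k + l)) ^ m ≤ 1 - A + A ^ 2 := by
    rw [div_le_iff₀ hp, mul_comm]
    exact (chooseRatio_le hl hm).trans
      (mul_le_mul_of_nonneg_left (exp_neg_le hA0 (hA₀.trans hA1)) hp.le)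
  have hB0 : 0 ≤ B := (abs_nonneg β).trans hB
  rw [mul_div_assoc]
  have h4 := mul_le_mul_of_nonneg_left h3 h1
  have h5 : (1 + m * β) * A ^ 2 ≤ 2 * A₀ ^ 2 :=
    mul_le_mul h2 (pow_le_pow_left₀ hA0 hA₀ 2) (by positivity) (by norm_num)
  have h6 : -(m * β * A) ≤ m * (B * A₀) := by
    have : -(β * A) ≤ B * A₀ := by
      calc -(β * A) = -β * A := by ring
        _ ≤ B * A := mul_le_mul_of_nonneg_right (by linarith) hA0
        _ ≤ B * A₀ := mul_le_mul_of_nonneg_left hA₀ hB0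
    nlinarith
  have h7 : 2 * A₀ ^ 2 ≤ m * (2 * A₀ ^ 2) := le_mul_of_one_le_left (by positivity) hm'
  have h8 : (m : ℝ) * (β - (m - 1) / 2 * (l / (k * (k + l))) + (2 * A₀ ^ 2 + B * A₀)) =
      m * β - A + m * (2 * A₀ ^ 2) + m * (B * A₀) := by rw [hA]; ring
  rw [h8]
  linarith

theorem quad_coeff_le {k l m : ℕ} (hk : 0 < k) (hl : 0 < l) (hm1 : 1 ≤ m) :
    (m : ℝ) * (m - 1) / 2 * (l / (k * (k + l))) ≤ m ^ 2 / k := by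
  have hk : (0 : ℝ) < k := by exact_mod_cast hk
  have hl' : (0 : ℝ) < l := by exact_mod_cast hl
  have hm' : (1 : ℝ) ≤ m := by exact_mod_cast hm1
  have h1 : (l : ℝ) / (k * (k + l)) ≤ 1 / k := by
    rw [div_le_div_iff₀ (by positivity) hk]
    nlinarith
  calc (m : ℝ) * (m - 1) / 2 * (l / (k * (k + l))) ≤ m ^ 2 * (1 / k) :=
        mul_le_mul (by nlinarith) h1 (by positivity) (by positivity)
    _ = _ := by ring

/-- The coefficient q³ + (p²-q²)q of γ collapses to p²q, so β and γ appear exactly in the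
combination p²(pβ + qγ) that the hypothesis controls. -/
theorem edge_terms_eq {k l : ℝ} (hk : 0 < k) (hl : 0 < l) (β γ m e : ℝ) :
    (k / (k + l)) ^ 3 * (β - (m - 1) / 2 * (l / (k * (k + l))) + e) +
      (l / (k + l)) ^ 3 * (γ - (m - 1) / 2 * (k / (l * (k + l))) + e) +
      ((k / (k + l)) ^ 2 - (l / (k + l)) ^ 2) * (l / (k + l)) * γ =
      (k ^ 2 / (k + l) ^ 3) * (k * β + l * γ) - (m - 1) * (k * l / (2 * (k + l) ^ 3)) +
        ((k / (k + l)) ^ 3 + (l / (k + l)) ^ 3) * e := by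
  have hK : 0 < k + l := by positivity
  have h1 : (k / (k + l)) ^ 3 * (l / (k * (k + l))) + (l / (k + l)) ^ 3 * (k / (l * (k + l))) =
      k * l / (k + l) ^ 3 := by
    field_simp
  have h2 : k * l / (2 * (k + l) ^ 3) = k * l / (k + l) ^ 3 / 2 := by
    field_simp
  rw [h2, ← h1]
  simp only [div_pow]
  generalize k + l = K
  ring

/-- Quantitative form of the main estimate, for cliques with at least two vertices. -/
theorem ramsey_le_of_quasirandom {k l m n : ℕ} {β γ B σ θ : ℝ} (hl : 0 < l) (hlk : l ≤ k)
    (hm : 2 ≤ m) (hml : m ≤ l)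
    (hR : ∀ j ∈ ({1, 2, m} : Set ℕ),
      (ramsey (k + 1 - j) (l + 1) : ℝ) ≤ (1 + j * β) * (chooseRatio k l j * n))
    (hR' : ∀ j ∈ ({1, 2, m} : Set ℕ),
      (ramsey (l + 1 - j) (k + 1) : ℝ) ≤ (1 + j * γ) * (chooseRatio l k j * n))
    (hβγ : k * β + l * γ ≤ ((m : ℝ) - 2) * l / (2 * k))
    (hB : |β| + |γ| ≤ B) (hmB : m * B ≤ 1) (hσ : 0 < σ) (hBσ : 4 * B * n + 4 ≤ σ ^ 2 * n)
    (hn : 1 ≤ σ ^ 6 * n) (hθ : 0 < θ) (hθq : 2 * θ ≤ ((l : ℝ) / (k + l)) ^ m)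
    (hσθ : 2 * m * σ ≤ θ ^ 4) (hA : (m : ℝ) ^ 2 / l ≤ 1)
    (hfinal : (2 * ((m : ℝ) ^ 2 / l) ^ 2 + B * (m ^ 2 / l)) +
      m * (22 * m ^ 3 * σ ^ 3 * θ⁻¹ ^ 8) + 4 * m / n < k * l / (2 * (k + l) ^ 3)) :
    ramsey (k + 1) (l + 1) ≤ n := by
  by_contra hlt
  have hn0 : 0 < n := by
    rcases Nat.eq_zero_or_pos n with rfl | h
    · norm_num at hn
    · exact h
  obtain ⟨G, hG, hG'⟩ := exists_graph_of_lt_ramsey hn0 (not_le.mp hlt)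
  have hGcc : ∀ s, ¬ Gᶜᶜ.IsNClique (k + 1) s := by rwa [compl_compl]
  have hk' : (0 : ℝ) < k := by exact_mod_cast (by omega : 0 < k)
  have hl' : (0 : ℝ) < l := by exact_mod_cast hl
  have hlk' : (l : ℝ) ≤ k := by exact_mod_cast hlk
  have hm' : (2 : ℝ) ≤ m := by exact_mod_cast hm
  have hcard : (Fintype.card (Fin n) : ℝ) = n := by simp
  have hβB : |β| ≤ B := by linarith [abs_nonneg γ]
  have hγB : |γ| ≤ B := by linarith [abs_nonneg β]
  have hB0 : 0 ≤ B := (abs_nonneg β).trans hβB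
  have hβ2 : 0 ≤ 1 + 2 * β := by nlinarith [(abs_le.mp hβB).1]
  have hγ2 : 0 ≤ 1 + 2 * γ := by nlinarith [(abs_le.mp hγB).1]
  have d : DegreeBounds G ((k : ℝ) / (k + l)) β :=
    degreeBounds_of_ramsey_le hG hG' hl (by omega) hβ2
      (by rw [hcard]; exact hR 1 (by simp)) (by rw [hcard]; exact hR 2 (by simp))
  have d' : DegreeBounds Gᶜ ((l : ℝ) / (l + k)) γ :=
    degreeBounds_of_ramsey_le hG' hGcc (by omega) (by omega) hγ2
      (by rw [hcard]; exact hR' 1 (by simp)) (by rw [hcard]; exact hR' 2 (by simp))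
  have hC (v : Fin m → Fin n) (hv : cliqueInd G v ≠ 0) :
      ∑ w, ∏ i, adjInd G w (v i) ≤ ((1 + m * β) * chooseRatio k l m) * Fintype.card (Fin n) := by
    rw [hcard, mul_assoc]
    exact (sum_prod_adjInd_lt_ramsey hG hG' (by omega) hv).le.trans (hR m (by simp))
  have hC' (v : Fin m → Fin n) (hv : cliqueInd Gᶜ v ≠ 0) :
      ∑ w, ∏ i, adjInd Gᶜ w (v i) ≤ ((1 + m * γ) * chooseRatio l k m) * Fintype.card (Fin n) := by
    rw [hcard, mul_assoc]
    exact (sum_prod_adjInd_lt_ramsey hG' hGcc (by omega) hv).le.trans (hR' m (by simp))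
  have hAk : (m : ℝ) ^ 2 / k ≤ m ^ 2 / l := by gcongr
  have E := chooseRatio_div_le (β := β) (A₀ := (m : ℝ) ^ 2 / l) hl (by omega : m ≤ k) (by omega)
    hβB hmB ((quad_coeff_le (by omega) hl (by omega)).trans hAk) hA
  have E' := chooseRatio_div_le (β := γ) (A₀ := (m : ℝ) ^ 2 / l) (by omega : 0 < k) hml (by omega)
    hγB hmB (quad_coeff_le hl (by omega) (by omega)) hA
  have hcomm : (l : ℝ) + k = k + l := add_comm _ _
  rw [hcomm] at d' E'
  have hpq : (k : ℝ) / (k + l) + l / (k + l) = 1 := by field_simp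
  have hqp : (l : ℝ) / (k + l) ≤ k / (k + l) := by gcongr
  have hθp : 2 * θ ≤ ((k : ℝ) / (k + l)) ^ m :=
    hθq.trans (pow_le_pow_left₀ (by positivity) hqp m)
  have Q : Quasirandom G ((k : ℝ) / (k + l)) σ θ m :=
    d.quasirandom d' hpq (by positivity) (by positivity) hB (by rwa [hcard]) hσ (by rwa [hcard]) hθ
      hθp hσθ hm
  have Q' : Quasirandom Gᶜ ((l : ℝ) / (k + l)) σ θ m :=
    d'.quasirandom (B := B) (by rwa [compl_compl]) (by rwa [add_comm]) (by positivity)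
      (by positivity) (by rwa [add_comm]) (by rwa [hcard]) hσ (by rwa [hcard]) hθ hθq hσθ hm
  have key := Q.linear_bound Q' d' hpq hqp hC hC' E E'
  rw [hcard] at key
  set e₁ := 2 * ((m : ℝ) ^ 2 / l) ^ 2 + B * (m ^ 2 / l) with he₁
  set e₂ := (m : ℝ) * (22 * m ^ 3 * σ ^ 3 * θ⁻¹ ^ 8) with he₂
  have he₁0 : 0 ≤ e₁ := by positivity
  have id1 := edge_terms_eq hk' hl' β γ m e₁
  -- The hypothesis on kβ + lγ contributes m-2 copies of kl/(2(k+l)³), while the binomial deficit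
  -- removes m-1. The one remaining copy has to beat all errors.
  have id2 : (k : ℝ) ^ 2 / (k + l) ^ 3 * (((m : ℝ) - 2) * l / (2 * k)) =
      (m - 2) * (k * l / (2 * (k + l) ^ 3)) := by
    field_simp
  have h1 := mul_le_mul_of_nonneg_left hβγ (show 0 ≤ (k : ℝ) ^ 2 / (k + l) ^ 3 by positivity)
  rw [id2] at h1
  have h2 : (((k : ℝ) / (k + l)) ^ 3 + ((l : ℝ) / (k + l)) ^ 3) * e₁ ≤ e₁ := by
    refine mul_le_of_le_one_left he₁0 ?_
    have hq0 : 0 ≤ (l : ℝ) / (k + l) := by positivity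
    have hp0 : 0 ≤ (k : ℝ) / (k + l) := by positivity
    have hp3 := pow_le_of_le_one hp0 (by linarith only [hq0, hpq]) three_ne_zero
    have hq3 := pow_le_of_le_one hq0 (by linarith only [hp0, hpq]) three_ne_zero
    linarith only [hp3, hq3, hpq]
  rw [id1] at key
  linarith only [key, h1, h2, hfinal]

/-- The case in which degree bounds alone suffice. -/
theorem ramsey_le_of_degrees {k l n : ℕ} {β γ : ℝ} (hl : 0 < l) (hk : 0 < k) (hn : 0 < n)
    (hR : (ramsey (k + 1 - 1) (l + 1) : ℝ) ≤ (1 + β) * (chooseRatio k l 1 * n))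
    (hR' : (ramsey (l + 1 - 1) (k + 1) : ℝ) ≤ (1 + γ) * (chooseRatio l k 1 * n))
    (hβγ : k * β + l * γ ≤ -(l / (2 * k : ℝ))) (hbig : (2 * k * (k + l) : ℝ) < n * l) :
    ramsey (k + 1) (l + 1) ≤ n := by
  by_contra hlt
  obtain ⟨G, hG, hG'⟩ := exists_graph_of_lt_ramsey hn (not_le.mp hlt)
  have hGcc : ∀ s, ¬ Gᶜᶜ.IsNClique (k + 1) s := by rwa [compl_compl]
  have hk' : (0 : ℝ) < k := by exact_mod_cast hk
  have hl' : (0 : ℝ) < l := by exact_mod_cast hl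
  let u : Fin n := ⟨0, hn⟩
  have hv (H : SimpleGraph (Fin n)) : cliqueInd H (fun _ : Fin 1 => u) ≠ 0 := by
    simp [cliqueInd, Subsingleton.pairwise]
  have h1 := (sum_prod_adjInd_lt_ramsey hG hG' (by omega) (hv G)).le.trans hR
  have h2 := (sum_prod_adjInd_lt_ramsey hG' hGcc (by omega) (hv Gᶜ)).le.trans hR'
  rw [chooseRatio_one _ (by assumption)] at h1 h2
  simp only [Finset.univ_unique, Finset.prod_singleton] at h1 h2
  have h3 : ∑ w, adjInd G w u + ∑ w, adjInd Gᶜ w u = n - 1 := by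
    have hpt (w : Fin n) : adjInd G w u + adjInd Gᶜ w u = 1 - if w = u then 1 else 0 := by
      by_cases hw : w = u
      · subst hw; simp [adjInd]
      · by_cases h : G.Adj w u <;> simp [adjInd, h, hw]
    rw [← Finset.sum_add_distrib, Finset.sum_congr rfl fun w _ => hpt w]
    simp [Finset.sum_sub_distrib]
  -- The two degrees of `u` sum to n-1; the negative bound on kβ + lγ together with the size of n
  -- brings the upper bound below that.
  have h4 : (n : ℝ) - 1 ≤ n + n / (k + l) * (k * β + l * γ) := by
    have e : (1 + β) * ((k : ℝ) / (k + l) * n) + (1 + γ) * ((l : ℝ) / (l + k) * n) =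
        n + n / (k + l) * (k * β + l * γ) := by
      rw [add_comm (l : ℝ) k]
      field_simp
      ring
    linarith
  have h5 := mul_le_mul_of_nonneg_left hβγ (show 0 ≤ (n : ℝ) / (k + l) by positivity)
  have h6 : (n : ℝ) / (k + l) * -(l / (2 * k : ℝ)) = -(n * l / (2 * k * (k + l))) := by
    field_simp
  have h7 : 1 < (n : ℝ) * l / (2 * k * (k + l)) := by
    rw [one_lt_div (by positivity)]; exact hbig
  rw [h6] at h5
  linarith

end Bridge

/-! ### Choice of scales -/

section Asymptotics

/-- All quantities become powers of t = k^(1/40). The main term is at least t⁻⁴¹/16 and the errors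
add up to at most 29t⁻⁴², so t ≥ 1000 suffices. -/
theorem ramsey_le_of_scale {ε t B β γ : ℝ} {k l m n : ℕ} (ht : 1000 ≤ t)
    (hεt : 1 ≤ ε * t) (hk : (k : ℝ) = t ^ 40) (hl : ε * k ≤ l) (hlk : l ≤ k) (hm : 2 ≤ m)
    (hmt : (m : ℝ) ≤ t) (hB : |β| + |γ| ≤ B) (hBt : B ≤ (t ^ 37)⁻¹) (hn : t ^ 120 ≤ n)
    (hθ : 2 * t⁻¹ ≤ ((l : ℝ) / (k + l)) ^ m)
    (hR : ∀ j ∈ ({1, 2, m} : Set ℕ),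
      (ramsey (k + 1 - j) (l + 1) : ℝ) ≤ (1 + j * β) * (chooseRatio k l j * n))
    (hR' : ∀ j ∈ ({1, 2, m} : Set ℕ),
      (ramsey (l + 1 - j) (k + 1) : ℝ) ≤ (1 + j * γ) * (chooseRatio l k j * n))
    (hβγ : k * β + l * γ ≤ ((m : ℝ) - 2) * l / (2 * k)) :
    ramsey (k + 1) (l + 1) ≤ n := by
  have ht0 : 0 < t := by linarith
  have ht1 : 1 ≤ t := by linarith
  have hB0 : 0 ≤ B := by linarith [abs_nonneg β, abs_nonneg γ]
  have hm0 : (2 : ℝ) ≤ m := by exact_mod_cast hm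
  have hl39 : t ^ 39 ≤ l := by
    calc t ^ 39 = 1 * t ^ 39 := by ring
      _ ≤ (ε * t) * t ^ 39 := by gcongr
      _ = ε * k := by rw [hk]; ring
      _ ≤ l := hl
  have hk0 : (0 : ℝ) < k := by rw [hk]; positivity
  have hl0 : (0 : ℝ) < l := lt_of_lt_of_le (by positivity) hl39
  have hn0 : (0 : ℝ) < n := lt_of_lt_of_le (by positivity) hn
  have hlk' : (l : ℝ) ≤ k := by exact_mod_cast hlk
  have hml : m ≤ l := by
    have : t ≤ t ^ 39 := le_self_pow₀ ht1 (by norm_num)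
    exact_mod_cast (hmt.trans this).trans hl39
  have hA : (m : ℝ) ^ 2 / l ≤ (t ^ 37)⁻¹ := by
    rw [div_le_iff₀ hl0]
    calc (m : ℝ) ^ 2 ≤ t ^ 2 := by gcongr
      _ = (t ^ 37)⁻¹ * t ^ 39 := by field_simp
      _ ≤ (t ^ 37)⁻¹ * l := by gcongr
  have hinv1 (a : ℕ) : (t ^ a)⁻¹ ≤ 1 := inv_le_one_of_one_le₀ (one_le_pow₀ ht1)
  -- σ² = t⁻³⁶ has to dominate 4B ≤ 4t⁻³⁷, while the cubic error m⁴σ³θ⁻⁸ ≤ t^(4-54+8) has to stay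
  -- below t⁻⁴¹.
  refine ramsey_le_of_quasirandom (σ := (t ^ 18)⁻¹) (θ := t⁻¹) (by exact_mod_cast hl0) hlk hm hml
    hR hR' hβγ hB ?_ (by positivity) ?_ ?_ (by positivity) hθ ?_ (hA.trans (hinv1 37)) ?_
  · calc (m : ℝ) * B ≤ t * (t ^ 37)⁻¹ := by gcongr
      _ = (t ^ 36)⁻¹ := by field_simp
      _ ≤ 1 := hinv1 36
  · have h1 : 4 * B * n ≤ (t ^ 36)⁻¹ / 2 * n := by
      refine mul_le_mul_of_nonneg_right ?_ hn0.le
      calc 4 * B ≤ 4 * (t ^ 37)⁻¹ := by gcongr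
        _ = (t ^ 36)⁻¹ * (4 / t) := by field_simp
        _ ≤ (t ^ 36)⁻¹ * (1 / 2) := by
          gcongr ?_ * ?_
          rw [div_le_div_iff₀ ht0 (by norm_num)]
          linarith
        _ = _ := by ring
    have h2 : 4 ≤ (t ^ 36)⁻¹ / 2 * n := by
      calc (4 : ℝ) ≤ t / 2 := by linarith
        _ ≤ t ^ 84 / 2 := by gcongr; exact le_self_pow₀ ht1 (by norm_num)
        _ = (t ^ 36)⁻¹ / 2 * t ^ 120 := by field_simp
        _ ≤ _ := by gcongr
    have h3 : ((t ^ 18)⁻¹) ^ 2 * (n : ℝ) = (t ^ 36)⁻¹ / 2 * n + (t ^ 36)⁻¹ / 2 * n := by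
      have : ((t ^ 18)⁻¹) ^ 2 = (t ^ 36)⁻¹ := by rw [inv_pow, ← pow_mul]
      rw [this]; ring
    rw [h3]
    linarith
  · calc (1 : ℝ) ≤ t ^ 12 := one_le_pow₀ ht1
      _ = ((t ^ 18)⁻¹) ^ 6 * t ^ 120 := by field_simp
      _ ≤ _ := by gcongr
  · calc 2 * (m : ℝ) * (t ^ 18)⁻¹ ≤ t * t * (t ^ 18)⁻¹ := by gcongr; linarith
      _ = (t⁻¹) ^ 4 * (t ^ 12)⁻¹ := by field_simp
      _ ≤ (t⁻¹) ^ 4 * 1 := by gcongr; exact hinv1 12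
      _ = _ := mul_one _
  · have h1 : 2 * ((m : ℝ) ^ 2 / l) ^ 2 + B * (m ^ 2 / l) ≤ 3 * (t ^ 42)⁻¹ := by
      calc 2 * ((m : ℝ) ^ 2 / l) ^ 2 + B * (m ^ 2 / l)
          ≤ 2 * ((t ^ 37)⁻¹) ^ 2 + (t ^ 37)⁻¹ * (t ^ 37)⁻¹ := by gcongr
        _ = 3 * (t ^ 42)⁻¹ * (t ^ 32)⁻¹ := by field_simp; norm_num
        _ ≤ 3 * (t ^ 42)⁻¹ * 1 := by gcongr; exact hinv1 32
        _ = _ := mul_one _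
    have h2 : (m : ℝ) * (22 * m ^ 3 * (t ^ 18)⁻¹ ^ 3 * t⁻¹⁻¹ ^ 8) ≤ 22 * (t ^ 42)⁻¹ := by
      rw [inv_inv]
      calc (m : ℝ) * (22 * m ^ 3 * (t ^ 18)⁻¹ ^ 3 * t ^ 8)
          ≤ t * (22 * t ^ 3 * (t ^ 18)⁻¹ ^ 3 * t ^ 8) := by gcongr
        _ = 22 * (t ^ 42)⁻¹ := by field_simp
    have h3 : 4 * (m : ℝ) / n ≤ 4 * (t ^ 42)⁻¹ := by
      rw [div_le_iff₀ hn0]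
      calc 4 * (m : ℝ) ≤ 4 * t := by gcongr
        _ ≤ 4 * t ^ 78 := by gcongr; exact le_self_pow₀ ht1 (by norm_num)
        _ = 4 * (t ^ 42)⁻¹ * t ^ 120 := by field_simp
        _ ≤ _ := by gcongr
    have h4 : (t ^ 41)⁻¹ / 16 ≤ (k : ℝ) * l / (2 * (k + l) ^ 3) := by
      calc (t ^ 41)⁻¹ / 16 = k * t ^ 39 / (2 * (k + k) ^ 3) := by
            rw [hk]; field_simp; norm_num
        _ ≤ k * l / (2 * (k + l) ^ 3) := by gcongr
    have h5 : 29 * (t ^ 42)⁻¹ < (t ^ 41)⁻¹ / 16 := by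
      have : (t ^ 41)⁻¹ = (t ^ 42)⁻¹ * t := by field_simp
      rw [this]
      have : 0 < (t ^ 42)⁻¹ := by positivity
      nlinarith
    linarith

theorem two_pow_le_choose {k l : ℕ} (hl : 0 < l) (hlk : l ≤ k) : 2 ^ l ≤ (k + l).choose k := by
  have h1 : 4 ^ l ≤ 2 * l * l.centralBinom := Nat.four_pow_le_two_mul_self_mul_centralBinom l hl
  have h2 : 2 * l ≤ 2 ^ l := by
    obtain ⟨j, rfl⟩ : ∃ j, l = j + 1 := ⟨l - 1, by omega⟩
    have := Nat.lt_two_pow_self (n := j)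
    rw [pow_succ]
    omega
  have h3 : l.centralBinom ≤ (k + l).choose k := by
    rw [Nat.centralBinom, Nat.choose_symm_add]
    exact Nat.choose_le_choose l (by omega)
  have h4 : 2 ^ l * 2 ^ l ≤ 2 ^ l * l.centralBinom := by
    calc 2 ^ l * 2 ^ l = 4 ^ l := (mul_pow 2 2 l).symm
      _ ≤ 2 * l * l.centralBinom := h1
      _ ≤ _ := Nat.mul_le_mul_right _ h2
  exact (Nat.le_of_mul_le_mul_left h4 (by positivity)).trans h3

theorem eventually_scale {ε : ℝ} (hε : 0 < ε) :
    ∀ᶠ k : ℕ in Filter.atTop, 1000 ≤ (k : ℝ) ^ (1 / 40 : ℝ) ∧ 1 ≤ ε * (k : ℝ) ^ (1 / 40 : ℝ) ∧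
      Real.log k ≤ (k : ℝ) ^ (1 / 40 : ℝ) ∧ 5 * Real.log k ^ 2 ≤ ε * Real.log 2 * k ∧
      1 ≤ Real.log k := by
  have hcast : Filter.Tendsto (fun k : ℕ => (k : ℝ)) Filter.atTop Filter.atTop :=
    tendsto_natCast_atTop_atTop
  have hroot : Filter.Tendsto (fun k : ℕ => (k : ℝ) ^ (1 / 40 : ℝ)) Filter.atTop Filter.atTop :=
    (tendsto_rpow_atTop (by norm_num)).comp hcast
  have hlog2 : 0 < Real.log 2 := Real.log_pos (by norm_num)
  have h3 := (isLittleO_log_rpow_atTop (show (0 : ℝ) < 1 / 40 by norm_num)).bound one_pos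
  have h4 := (Real.isLittleO_pow_log_id_atTop (n := 2)).bound
    (show 0 < ε * Real.log 2 / 5 by positivity)
  filter_upwards [hroot.eventually_ge_atTop 1000, hroot.eventually_ge_atTop ε⁻¹,
    hcast.eventually h3, hcast.eventually h4,
    (Real.tendsto_log_atTop.comp hcast).eventually_ge_atTop 1] with k h1 h2 h3 h4 h5
  refine ⟨h1, ?_, ?_, ?_, h5⟩
  · calc (1 : ℝ) = ε * ε⁻¹ := by field_simp
      _ ≤ _ := by gcongr
  · rw [one_mul, Real.norm_of_nonneg (by positivity : (0 : ℝ) ≤ (k : ℝ) ^ (1 / 40 : ℝ))] at h3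
    exact (le_abs_self _).trans h3
  · simp only [id, Real.norm_eq_abs, abs_pow, sq_abs, Nat.abs_cast] at h4
    linarith

/-- The factor a may be as small as exp(-L²), but the binomial is at least 2^l ≥ exp(ε·log 2·k). As
4L + L² ≤ 5L², the product is at least k⁴ = t^160, ample room for the floor. -/
theorem pow_le_floor {ε t L a : ℝ} {k l r : ℕ} (ht : 1000 ≤ t) (hkt : (k : ℝ) = t ^ 40)
    (hL : L = Real.log k) (hl : 0 < l) (hlk : l ≤ k) (hlε : ε * k ≤ l)
    (hLk : 5 * L ^ 2 ≤ ε * Real.log 2 * k) (hL1 : 1 ≤ L) (hrL : (r : ℝ) ≤ L)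
    (ha : Real.exp (-((r : ℝ) * ((l : ℝ) / (k : ℝ)) * L)) ≤ a) :
    t ^ 120 ≤ (⌊a * ((k + l).choose k : ℝ)⌋₊ : ℝ) := by
  have hk' : (0 : ℝ) < k := by exact_mod_cast hl.trans_le hlk
  have hapos : 0 < a := (Real.exp_pos _).trans_le ha
  have hlk1 : (l : ℝ) / k ≤ 1 := (div_le_one hk').mpr (by exact_mod_cast hlk)
  have h1 : Real.exp (4 * L) ≤ a * ((k + l).choose k : ℝ) := by
    have h2 : Real.exp (-(L * L)) ≤ a := by
      refine le_trans (Real.exp_le_exp.mpr (neg_le_neg ?_)) ha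
      refine mul_le_mul_of_nonneg_right ?_ (by linarith)
      calc (r : ℝ) * (l / k) ≤ L * 1 := mul_le_mul hrL hlk1 (by positivity) (by linarith)
        _ = L := mul_one L
    have h3 : Real.exp (ε * Real.log 2 * k) ≤ ((k + l).choose k : ℝ) := by
      calc Real.exp (ε * Real.log 2 * k) ≤ Real.exp (Real.log 2 * l) := by
            refine Real.exp_le_exp.mpr ?_
            have := mul_le_mul_of_nonneg_left hlε (Real.log_nonneg one_le_two)
            linarith
        _ = 2 ^ l := by
            rw [Real.exp_mul, Real.exp_log (by norm_num), Real.rpow_natCast]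
        _ ≤ _ := by exact_mod_cast two_pow_le_choose hl hlk
    calc Real.exp (4 * L) ≤ Real.exp (-(L * L) + ε * Real.log 2 * k) := by
          refine Real.exp_le_exp.mpr ?_
          nlinarith
      _ = Real.exp (-(L * L)) * Real.exp (ε * Real.log 2 * k) := Real.exp_add _ _
      _ ≤ _ := mul_le_mul h2 h3 (Real.exp_pos _).le hapos.le
  have h4 : Real.exp (4 * L) = t ^ 160 := by
    have : Real.exp (4 * L) = Real.exp L ^ 4 := by rw [← Real.exp_nat_mul]; norm_num
    rw [this, hL, Real.exp_log hk', hkt, ← pow_mul]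
  have h5 : t ^ 120 + 1 ≤ t ^ 160 := by
    have h6 : 1 ≤ t ^ 120 := one_le_pow₀ (by linarith)
    have h7 : t ≤ t ^ 40 := le_self_pow₀ (by linarith) (by norm_num)
    calc t ^ 120 + 1 ≤ t ^ 120 * 1000 := by linarith
      _ ≤ t ^ 120 * t ^ 40 := by gcongr; linarith
      _ = t ^ 160 := by ring
  have h8 : a * ((k + l).choose k : ℝ) < ⌊a * ((k + l).choose k : ℝ)⌋₊ + 1 := Nat.lt_floor_add_one _
  linarith

/-- Since q ≥ ε/2 and m ≤ c·log k, q^m is at least k^(-1/80), the square root of t⁻¹, and this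
exceeds 2t⁻¹ as soon as t ≥ 4. -/
theorem two_mul_inv_le_pow {ε t c : ℝ} {k l m : ℕ} (hε : 0 < ε) (ht : 1000 ≤ t)
    (ht' : t = (k : ℝ) ^ (1 / 40 : ℝ)) (hk' : (0 : ℝ) < k) (hlε : ε * k ≤ l) (hlk' : (l : ℝ) ≤ k)
    (hcε : c * |Real.log (ε / 2)| ≤ 1 / 80) (hL0 : 0 ≤ Real.log k) (hmc : (m : ℝ) ≤ c * Real.log k) :
    2 * t⁻¹ ≤ ((l : ℝ) / (k + l)) ^ m := by
  have ht0 : 0 < t := by linarith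
  have hl' : (0 : ℝ) < l := lt_of_lt_of_le (by positivity) hlε
  have hq : ε / 2 ≤ (l : ℝ) / (k + l) := by
    rw [div_le_div_iff₀ (by norm_num) (by positivity)]
    nlinarith
  have hexp : (ε / 2) ^ m = Real.exp ((m : ℝ) * Real.log (ε / 2)) := by
    rw [mul_comm, Real.exp_mul, Real.exp_log (by positivity), Real.rpow_natCast]
  have h1 : -(Real.log k / 80) ≤ (m : ℝ) * Real.log (ε / 2) := by
    have h2 := neg_abs_le (Real.log (ε / 2))
    have h3 : (m : ℝ) * |Real.log (ε / 2)| ≤ (c * Real.log k) * |Real.log (ε / 2)| :=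
      mul_le_mul_of_nonneg_right hmc (abs_nonneg _)
    have h4 : (c * Real.log k) * |Real.log (ε / 2)| ≤ Real.log k / 80 := by
      have := mul_le_mul_of_nonneg_right hcε (hL0)
      linarith
    have h5 := mul_le_mul_of_nonneg_left h2 (Nat.cast_nonneg (α := ℝ) m)
    linarith
  have h6 : Real.exp (-(Real.log k / 80)) ^ 2 = t⁻¹ := by
    rw [← Real.exp_nat_mul, ht', Real.rpow_def_of_pos hk', ← Real.exp_neg]
    congr 1
    push_cast
    ring
  have h7 : 2 * t⁻¹ ≤ Real.exp (-(Real.log k / 80)) := by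
    have h8 := Real.exp_pos (-(Real.log k / 80))
    set s := Real.exp (-(Real.log k / 80))
    have h9 : s ^ 2 ≤ (1 / 4 : ℝ) := by
      rw [h6, inv_le_comm₀ ht0 (by norm_num)]
      linarith
    rw [← h6]
    nlinarith
  calc 2 * t⁻¹ ≤ Real.exp (-(Real.log k / 80)) := h7
    _ ≤ (ε / 2) ^ m := by rw [hexp]; exact Real.exp_le_exp.mpr h1
    _ ≤ _ := pow_le_pow_left₀ (by positivity) hq _

theorem two_mul_mul_lt {k l n : ℝ} (hk : 1000 ≤ k) (hl : 1 ≤ l) (hlk : l ≤ k) (hn : k ^ 3 ≤ n) :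
    2 * k * (k + l) < n * l := by
  have hn0 : 0 ≤ n := le_trans (by positivity) hn
  have h4 : n ≤ n * l := le_mul_of_one_le_right hn0 hl
  have h5 : 2 * k * (k + l) ≤ 4 * k ^ 2 := by nlinarith
  have h6 : 4 * k ^ 2 < k ^ 3 := by nlinarith [mul_pos (show 0 < k by linarith) (show 0 < k by linarith)]
  linarith

theorem alphaStar_eq {α : ℕ → ℕ → ℝ} {k l : ℕ} (h : 0 ≤ α k l) :
    alphaStar α k l =
      (⌊α k l * ((k + l).choose k : ℝ)⌋₊ : ℝ) / ((k + l).choose k : ℝ) := by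
  rw [alphaStar, natCast_floor_eq_intCast_floor (by positivity)]

/-- Dividing by `alphaStar` rather than by α is what makes the integer s = n appear exactly. -/
theorem le_of_div_alphaStar_le {R a s C D x : ℝ} (hs : 0 < s) (hD : 0 ≤ D)
    (h1 : R ≤ a * D) (h2 : a / (s / C) ≤ x) (hC : 0 < C) : R ≤ x * (D / C * s) := by
  rw [div_le_iff₀ (by positivity)] at h2
  calc R ≤ a * D := h1
    _ ≤ x * (s / C) * D := by gcongr
    _ = _ := by ring

end Asymptotics

end RamseyBound

/-! ### The main theorem -/

theorem mainTheorem5 (ε : ℝ) (hε : 0 < ε) :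
    ∃ c : ℝ, 0 < c ∧
      ∀ (α : ℕ → ℕ → ℝ) (β γ : ℝ) (k l r : ℕ),
        (∀ x y : ℕ, 0 < x → 0 < y → 0 < α x y) →
        (∀ x y : ℕ, 0 < x → 0 < y → α x y = α y x) →
        RamseyBound.IsSmooth α β γ k l r →
        ε ≤ (l : ℝ) / (k : ℝ) →
        (l : ℝ) / (k : ℝ) ≤ 1 →
        |β| + |γ| ≤ (r : ℝ) * Real.log (k : ℝ) ^ 2 / (k : ℝ) →
        Real.exp (-((r : ℝ) * ((l : ℝ) / (k : ℝ)) * Real.log (k : ℝ))) ≤ α k l →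
        (r : ℝ) ≤ c * Real.log (k : ℝ) →
        (k : ℝ) * β + (l : ℝ) * γ ≤ ((r : ℝ) - 3) * (l : ℝ) / (2 * (k : ℝ)) →
        (RamseyBound.ramsey (k + 1) (l + 1) : ℝ) ≤ α k l * ((k + l).choose k : ℝ) := by
  obtain ⟨k₀, hk₀⟩ := Filter.eventually_atTop.mp (RamseyBound.eventually_scale hε)
  have hlogε : 0 ≤ |Real.log (ε / 2)| := abs_nonneg _
  have hlogk₀ : 0 ≤ Real.log (k₀ + 1) := Real.log_nonneg (by linarith [Nat.cast_nonneg (α := ℝ) k₀])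
  -- The three summands ensure, in turn, r ≤ log k, the lower bound on q^m, and k ≥ k₀ whenever r ≥
  -- 2.
  set c : ℝ := 1 / (1 + 80 * |Real.log (ε / 2)| + Real.log (k₀ + 1)) with hc
  have hden : 1 ≤ 1 + 80 * |Real.log (ε / 2)| + Real.log (k₀ + 1) := by linarith
  have hc0 : 0 < c := by positivity
  have hcden : c * (1 + 80 * |Real.log (ε / 2)| + Real.log (k₀ + 1)) = 1 := by
    rw [hc]; field_simp
  have hc1 : c ≤ 1 := by nlinarith
  have hcε : c * |Real.log (ε / 2)| ≤ 1 / 80 := by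
    nlinarith [mul_nonneg hc0.le hlogk₀]
  have hck : c * Real.log (k₀ + 1) ≤ 1 := by
    nlinarith [mul_nonneg hc0.le hlogε]
  refine ⟨c, hc0, ?_⟩
  intro α β γ k l r hα _ hsm hεl hlk hβγ hαl hr hlin
  have hC0 : 0 < (k + l).choose k := Nat.choose_pos (by omega)
  have hC0' : (0 : ℝ) < ((k + l).choose k : ℕ) := by exact_mod_cast hC0
  have hchs : (k + l).choose k = (k + l).choose l := Nat.choose_symm_add
  -- For r ≤ 1 the truncated difference r - 1 is 0, and the smoothness condition for m = 0 is the
  -- claim itself.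
  rcases Nat.lt_or_ge r 2 with hr1 | hr2
  · have hr0 : r - 1 = 0 := by omega
    have h := (hsm 0 (by simp [hr0])).1
    simpa [hchs] using h
  -- For k = 0 the quotient l/k is 0 by convention, which is less than ε.
  have hk : 0 < k := by
    rcases Nat.eq_zero_or_pos k with rfl | h
    · simp at hεl; linarith
    · exact h
  have hk' : (0 : ℝ) < k := by exact_mod_cast hk
  have hlε : ε * k ≤ l := (le_div_iff₀ hk').mp hεl
  have hl' : (0 : ℝ) < l := lt_of_lt_of_le (by positivity) hlε
  have hl : 0 < l := by exact_mod_cast hl'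
  have hlk' : (l : ℝ) ≤ k := by simpa using (div_le_iff₀ hk').mp hlk
  have hlkn : l ≤ k := by exact_mod_cast hlk'
  have hr2' : (2 : ℝ) ≤ r := by exact_mod_cast hr2
  -- c·log k ≥ r ≥ 2 whereas c·log(k₀+1) ≤ 1, so k is automatically large.
  have hkk₀ : k₀ ≤ k := by
    have h1 : Real.log (k₀ + 1) < Real.log k := by nlinarith
    have h2 := (Real.log_lt_log_iff (by positivity) hk').mp h1
    have h3 : (k₀ : ℝ) ≤ k := by linarith
    exact_mod_cast h3
  obtain ⟨ht, hεt, hLt, hLk, hL1⟩ := hk₀ k hkk₀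
  set t : ℝ := (k : ℝ) ^ (1 / 40 : ℝ) with htdef
  set L : ℝ := Real.log k with hL
  have hkt : (k : ℝ) = t ^ 40 := by
    rw [htdef, ← Real.rpow_natCast, ← Real.rpow_mul hk'.le]
    norm_num
  have ht0 : 0 < t := by linarith
  have hrL : (r : ℝ) ≤ L := hr.trans (mul_le_of_le_one_left (by linarith) hc1)
  set n : ℕ := ⌊α k l * ((k + l).choose k : ℝ)⌋₊ with hn
  have hαpos := hα k l hk hl
  have hnle : (n : ℝ) ≤ α k l * ((k + l).choose k : ℝ) := Nat.floor_le (by positivity)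
  have hnt : t ^ 120 ≤ n :=
    RamseyBound.pow_le_floor ht hkt hL hl hlkn hlε hLk hL1 hrL hαl
  have hn0' : (0 : ℝ) < n := lt_of_lt_of_le (by positivity) hnt
  have hn0 : 0 < n := by exact_mod_cast hn0'
  have hstar : RamseyBound.alphaStar α k l = (n : ℝ) / ((k + l).choose k : ℝ) :=
    RamseyBound.alphaStar_eq hαpos.le
  have hR (j : ℕ) (hj : j ∈ ({1, 2, r - 1} : Set ℕ)) :
      (RamseyBound.ramsey (k + 1 - j) (l + 1) : ℝ) ≤
        (1 + j * β) * (RamseyBound.chooseRatio k l j * n) := by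
    obtain ⟨h1, h2, -, -⟩ := hsm j hj
    rw [hstar] at h2
    rw [RamseyBound.chooseRatio, ← hchs]
    exact RamseyBound.le_of_div_alphaStar_le hn0' (by positivity) h1 h2 hC0'
  have hR' (j : ℕ) (hj : j ∈ ({1, 2, r - 1} : Set ℕ)) :
      (RamseyBound.ramsey (l + 1 - j) (k + 1) : ℝ) ≤
        (1 + j * γ) * (RamseyBound.chooseRatio l k j * n) := by
    obtain ⟨-, -, h1, h2⟩ := hsm j hj
    rw [hstar] at h2
    rw [RamseyBound.chooseRatio, RamseyBound.ramsey_comm, add_comm l k]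
    exact RamseyBound.le_of_div_alphaStar_le hn0' (by positivity) h1 h2 hC0'
  refine le_trans ?_ hnle
  rw [Nat.cast_le]
  -- For r = 2 cliques have m = 1 vertex and there are no pairs to weigh, so the degree argument
  -- takes over.
  rcases Nat.eq_or_lt_of_le hr2 with rfl | hr3
  · refine RamseyBound.ramsey_le_of_degrees hl hk hn0 (by simpa using hR 1 (by simp))
      (by simpa using hR' 1 (by simp)) (hlin.trans (le_of_eq ?_)) ?_
    · push_cast; ring
    · exact RamseyBound.two_mul_mul_lt
        (by rw [hkt]; exact ht.trans (le_self_pow₀ (by linarith only [ht]) (by norm_num)))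
        (by exact_mod_cast hl) hlk' (by rw [hkt, ← pow_mul]; exact hnt)
  · have hrm : ((r - 1 : ℕ) : ℝ) = r - 1 := by rw [Nat.cast_sub (by omega), Nat.cast_one]
    refine RamseyBound.ramsey_le_of_scale ht hεt hkt hlε hlkn (m := r - 1) (by omega)
      (by rw [hrm]; linarith) hβγ ?_ hnt ?_ hR hR' ?_
    · calc (r : ℝ) * L ^ 2 / k ≤ t * t ^ 2 / k := by gcongr; linarith
        _ = (t ^ 37)⁻¹ := by rw [hkt]; field_simp
    · exact RamseyBound.two_mul_inv_le_pow hε ht htdef hk' hlε hlk' hcε (by linarith)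
        (by rw [hrm]; linarith)
    · rw [hrm]
      refine hlin.trans (le_of_eq ?_)
      ring
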